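/- For $\operatorname{Re} x>0$ let $\theta_3(x)=\sum_{n=-\infty}^{\infty}e^{-\pi n^2x}$, and for $|z|<1$ let $$\sigma_3(z)=\frac{1}{\sqrt{1+z}}\,\theta_3\!\left(\frac{1-z}{1+z}\right)$$ (principal branch of the square root). Put $\Omega=\dfrac{\Gamma(1/4)^8}{32\pi^4}$ and $\Phi=\dfrac{\Omega}{4}=\dfrac{\Gamma(1/4)^8}{128\pi^4}$. There is a sequence of integers $(d(n))_{n\ge 0}$ such that $$\sigma_3(z)=\theta_3(1)\sum_{n=0}^\infty\frac{d(n)}{(2n)!}\,\Phi^n z^{2n}\qquad\text{for all complex } z \text{ with } |z|<1,$$ and $(d(n))$ is the only sequence of complex numbers with this property. It is also the sequence given by the derivatives of $\theta_3$ at $1$: it is the only sequence of complex numbers for which $$\theta_3^{(n)}(1)=\theta_3(1)\cdot\frac{(-1)^n}{4^n}\sum_{k=0}^{\lfloor n/2\rfloor}\frac{(2n)!}{2^{n-2k}(4k)!\,(n-2k)!}\,d(k)\,\Omega^k\qquad\text{for all } n\ge 0.$$ Moreover $\sigma_3(-z)=\sigma_3(z)$ for $|z|<1$, and $\theta_3(1/x)=\sqrt{x}\,\theta_3(x)$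 for $\operatorname{Re}x>0$ (principal branch). -/

import Mathlib

/-- The Jacobi theta constant `θ₃(x) = ∑_{n ∈ ℤ} exp (-π n² x)`; the series converges (absolutely)
for `Re x > 0`, which is the only region where the function is used. -/
noncomputable def theta3 (x : ℂ) : ℂ :=
  ∑' n : ℤ, Complex.exp (-(Real.pi : ℂ) * (n : ℂ) ^ 2 * x)

/-- The centered function `σ₃(z) = (1 + z)^(-1/2) θ₃((1 - z)/(1 + z))`, used for `|z| < 1`, with the
principal branch of the square root (for `|z| < 1` one has `Re (1 + z) > 0`). -/
noncomputable def sigma3 (z : ℂ) : ℂ :=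
  (1 + z) ^ (-(1 / 2) : ℂ) * theta3 ((1 - z) / (1 + z))

/-- The constant `Ω = Γ(1/4)⁸ / (32 π⁴)`. -/
noncomputable def Omega3 : ℝ := Real.Gamma (1 / 4) ^ 8 / (32 * Real.pi ^ 4)

/-- The constant `Φ = Γ(1/4)⁸ / (128 π⁴)`. -/
noncomputable def Phi3 : ℝ := Real.Gamma (1 / 4) ^ 8 / (128 * Real.pi ^ 4)

/-- The number sequence `a` consists of the normalized Taylor coefficients of `σ₃`:
`σ₃(z) = θ₃(1) ∑_{n ≥ 0} a(n)/(2n)! Φⁿ z^(2n)` for all `|z| < 1`, with convergence of the series. -/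
def IsSigmaTaylor (a : ℕ → ℂ) : Prop :=
  ∀ z : ℂ, ‖z‖ < 1 →
    HasSum (fun n : ℕ =>
      theta3 1 * (a n / ((2 * n).factorial : ℂ) * (Phi3 : ℂ) ^ n * z ^ (2 * n))) (sigma3 z)

/-- The number sequence `a` expresses the derivatives of `θ₃` at `1`:
`θ₃⁽ⁿ⁾(1) = θ₃(1) (-1)ⁿ/4ⁿ ∑_{0 ≤ k ≤ n/2} (2n)!/(2^(n-2k) (4k)! (n-2k)!) a(k) Ωᵏ`. -/
def IsThetaTaylor (a : ℕ → ℂ) : Prop :=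
  ∀ n : ℕ, iteratedDeriv n theta3 1 =
    theta3 1 * ((-1) ^ n / 4 ^ n) *
      ∑ k ∈ Finset.range (n / 2 + 1),
        ((2 * n).factorial : ℂ) /
          (2 ^ (n - 2 * k) * ((4 * k).factorial : ℂ) * ((n - 2 * k).factorial : ℂ)) *
          a k * (Omega3 : ℂ) ^ k

/-! With nome q = exp (-πx), write θ₃ = ϑ(q), θ₄ = ϑ(-q), θ₂⁴ = θ₃⁴ - θ₄⁴ and L = qϑ'/ϑ. The theta
constants satisfy a closed first-order differential system, which becomes autonomous in the disk
coordinate z. Suitably scaled, it has integer coefficients and integer initial values, so all its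
derivatives at z = 0 are integers up to powers of the scale.

The system rests on the doubling q ↦ q². Rotating the lattice ℤ² gives Landen's identities
(`nomeTheta_sq_add_sq`, `nomeTheta_mul_nomeTheta_neg`). Iterating them drives q to 0, where
everything is known to first order; this yields `logDerivTheta_sub_neg` and the Riccati equation
`mul_deriv_logDerivTheta`.

In z the unknowns are σ₃, its logarithmic derivative and the modulus m = 1 - 2θ₄⁴/θ₃⁴. Evenness of
σ₃, which is the modularity x ↦ 1/x, forces the last two to vanish at z = 0 (`logDerivSigma_zero`,
`diskModulus_zero`). Integrality is `exists_int_iteratedDeriv_eq`, with squared scale π²θ₃(1)⁸/8.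

That this equals Φ is `theta3_one_pow_eight`: by Landen, θ₃² and θ₄² have arithmetic-geometric mean
1, while m = 0 gives θ₃² = √2 θ₄² at x = 1. Gauss's elliptic integral then reduces to B(1/4, 1/2).
The derivatives of θ₃ at 1 follow by differentiating through the Cayley transform. -/

open Filter Topology MeasureTheory Set

/-! ### The theta constant as an analytic function of the nome -/

/-- Jacobi's theta constant as a function of the nome, `∑_{n ∈ ℤ} q ^ (n²)`. -/
noncomputable def nomeTheta (q : ℂ) : ℂ := ∑' n : ℤ, q ^ (n.natAbs ^ 2)

theorem summable_pow_natAbs {r : ℝ} (h0 : 0 ≤ r) (h1 : r < 1) :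
    Summable fun n : ℤ => r ^ n.natAbs := by
  refine Summable.of_nat_of_neg ?_ ?_ <;>
  simpa using summable_geometric_of_lt_one h0 h1

theorem summable_pow_natAbs_sq {r : ℝ} (h0 : 0 ≤ r) (h1 : r < 1) :
    Summable fun n : ℤ => r ^ (n.natAbs ^ 2) :=
  (summable_pow_natAbs h0 h1).of_nonneg_of_le (fun _ => by positivity)
    fun n => pow_le_pow_of_le_one h0 h1.le (Nat.le_self_pow two_ne_zero _)

theorem summable_norm_nomeTheta {q : ℂ} (hq : ‖q‖ < 1) :
    Summable fun n : ℤ => ‖q ^ (n.natAbs ^ 2)‖ := by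
  simpa using summable_pow_natAbs_sq (norm_nonneg q) hq

theorem isOpen_norm_lt_one : IsOpen {q : ℂ | ‖q‖ < 1} :=
  isOpen_lt continuous_norm continuous_const

theorem differentiableAt_nomeTheta {q : ℂ} (hq : ‖q‖ < 1) : DifferentiableAt ℂ nomeTheta q := by
  obtain ⟨r, hr, hr1⟩ := exists_between hq
  have hopen : IsOpen {q : ℂ | ‖q‖ < r} := isOpen_lt continuous_norm continuous_const
  have : DifferentiableOn ℂ nomeTheta {q : ℂ | ‖q‖ < r} := by
    refine Complex.differentiableOn_tsum_of_summable_norm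
      (summable_pow_natAbs_sq ((norm_nonneg q).trans hr.le) hr1) (fun n => ?_) hopen ?_
    · fun_prop
    · intro n w hw
      rw [norm_pow]
      exact pow_le_pow_left₀ (norm_nonneg _) (le_of_lt hw) _
  exact this.differentiableAt (hopen.mem_nhds hr)

theorem analyticOnNhd_nomeTheta : AnalyticOnNhd ℂ nomeTheta {q : ℂ | ‖q‖ < 1} :=
  DifferentiableOn.analyticOnNhd
    (fun _ hq => (differentiableAt_nomeTheta hq).differentiableWithinAt) isOpen_norm_lt_one

theorem nomeTheta_zero : nomeTheta 0 = 1 := by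
  rw [nomeTheta, tsum_eq_single 0]
  · simp
  · intro n hn
    simp [hn]

theorem deriv_nomeTheta_zero : deriv nomeTheta 0 = 2 := by
  have hopen : IsOpen {q : ℂ | ‖q‖ < 1 / 2} := isOpen_lt continuous_norm continuous_const
  have h : HasSum (fun n : ℤ => deriv (fun q : ℂ => q ^ (n.natAbs ^ 2)) 0) (deriv nomeTheta 0) := by
    refine Complex.hasSum_deriv_of_summable_norm
      (summable_pow_natAbs_sq (r := 1 / 2) (by norm_num) (by norm_num)) (fun n => ?_) hopen ?_
      (by simp)
    · fun_prop
    · intro n w hw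
      rw [norm_pow]
      exact pow_le_pow_left₀ (norm_nonneg _) (le_of_lt hw) _
  rw [← h.tsum_eq, tsum_eq_sum (s := {1, -1})]
  · simp
    norm_num
  · intro n hn
    simp only [Finset.mem_insert, Finset.mem_singleton, not_or] at hn
    simp only [deriv_pow_field, mul_eq_zero, Nat.cast_eq_zero]
    by_cases h0 : n = 0
    · simp [h0]
    · right
      have : 2 ≤ n.natAbs := by omega
      have : 4 ≤ n.natAbs ^ 2 := by nlinarith
      exact zero_pow (by omega)

/-! ### Landen's identities and non-vanishing -/

theorem norm_sq_lt_one {q : ℂ} (hq : ‖q‖ < 1) : ‖q ^ 2‖ < 1 := by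
  rw [norm_pow]
  exact pow_lt_one₀ (norm_nonneg _) hq two_ne_zero

theorem norm_neg_lt_one {q : ℂ} (hq : ‖q‖ < 1) : ‖-q‖ < 1 := by rwa [norm_neg]

theorem neg_pow_natAbs_sq (q : ℂ) (n : ℤ) :
    (-q) ^ (n.natAbs ^ 2) = (-1) ^ n.natAbs * q ^ (n.natAbs ^ 2) := by
  rw [neg_pow]
  congr 1
  rcases Nat.even_or_odd n.natAbs with h | h
  · rw [h.neg_one_pow, (h.pow_of_ne_zero two_ne_zero).neg_one_pow]
  · rw [h.neg_one_pow, h.pow.neg_one_pow]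

theorem hasSum_nomeTheta_mul {p q : ℂ} (hp : ‖p‖ < 1) (hq : ‖q‖ < 1) :
    HasSum (fun m : ℤ × ℤ => p ^ (m.1.natAbs ^ 2) * q ^ (m.2.natAbs ^ 2))
      (nomeTheta p * nomeTheta q) := by
  have h := tsum_mul_tsum_of_summable_norm (summable_norm_nomeTheta hp) (summable_norm_nomeTheta hq)
  rw [nomeTheta, nomeTheta, h]
  exact (summable_mul_of_summable_norm (summable_norm_nomeTheta hp)
    (summable_norm_nomeTheta hq)).hasSum

theorem HasSum.of_forall_eq {ι : Type*} {f g : ι → ℂ} {a : ℂ} (hf : HasSum f a)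
    (h : ∀ i, g i = f i) : HasSum g a :=
  (funext h : g = f) ▸ hf

/-- A sum over `ℤ²` supported on pairs with even sum may be rotated by `(a, b) ↦ (a + b, a - b)`. -/
theorem HasSum.comp_add_sub {f : ℤ × ℤ → ℂ} {s : ℂ} (h : HasSum f s)
    (hf : ∀ m n, Odd (m + n) → f (m, n) = 0) :
    HasSum (fun a : ℤ × ℤ => f (a.1 + a.2, a.1 - a.2)) s := by
  have hinj : Function.Injective fun a : ℤ × ℤ => (a.1 + a.2, a.1 - a.2) := by
    rintro ⟨a, b⟩ ⟨c, d⟩ h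
    simp only [Prod.mk.injEq] at h ⊢
    omega
  refine (hinj.hasSum_iff (f := f) ?_).2 h
  rintro ⟨m, n⟩ hmn
  refine hf m n ?_
  by_contra he
  rw [Int.not_odd_iff_even] at he
  obtain ⟨k, hk⟩ := he
  exact hmn ⟨(k, m - k), by simp only [Prod.mk.injEq]; omega⟩

theorem natAbs_add_sq_add_natAbs_sub_sq (a b : ℤ) :
    (a + b).natAbs ^ 2 + (a - b).natAbs ^ 2 = 2 * a.natAbs ^ 2 + 2 * b.natAbs ^ 2 := by
  zify
  simp only [sq_abs]
  ring

/-- The weight 1 + (-1)^(m+n) restricts the double sum to even m + n, and the rotation doubles the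
quadratic form m² + n², replacing q by q². -/
theorem nomeTheta_sq_add_sq {q : ℂ} (hq : ‖q‖ < 1) :
    nomeTheta q ^ 2 + nomeTheta (-q) ^ 2 = 2 * nomeTheta (q ^ 2) ^ 2 := by
  have hq' := norm_neg_lt_one hq
  have h1 := (hasSum_nomeTheta_mul hq hq).add (hasSum_nomeTheta_mul hq' hq')
  have h2 := h1.comp_add_sub ?_
  · have h3 := ((hasSum_nomeTheta_mul (norm_sq_lt_one hq) (norm_sq_lt_one hq)).mul_left 2)
    rw [sq, sq, sq]
    refine h2.unique (h3.of_forall_eq fun a => ?_)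
    simp only [neg_pow_natAbs_sq]
    have e : Even ((a.1 + a.2).natAbs + (a.1 - a.2).natAbs) := by
      rw [Nat.even_iff]; omega
    have e2 := e.neg_one_pow (α := ℂ)
    rw [pow_add] at e2
    have e3 := congrArg (fun k => q ^ k) (natAbs_add_sq_add_natAbs_sub_sq a.1 a.2)
    simp only [pow_add, pow_mul] at e3
    linear_combination 2 * e3 + q ^ ((a.1 + a.2).natAbs ^ 2) * q ^ ((a.1 - a.2).natAbs ^ 2) * e2
  · intro m n hmn
    simp only [neg_pow_natAbs_sq]
    have e : Odd (m.natAbs + n.natAbs) := by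
      rw [Int.odd_iff] at hmn
      rw [Nat.odd_iff]; omega
    have e2 := e.neg_one_pow (α := ℂ)
    rw [pow_add] at e2
    linear_combination q ^ (m.natAbs ^ 2) * q ^ (n.natAbs ^ 2) * e2

/-- After symmetrizing, the weight (-1)^m + (-1)^n kills odd m + n; under the rotation the surviving
sign is (-1)^(a-b) = (-1)^a (-1)^b, which moves the nome to -q². -/
theorem nomeTheta_mul_nomeTheta_neg {q : ℂ} (hq : ‖q‖ < 1) :
    nomeTheta q * nomeTheta (-q) = nomeTheta (-q ^ 2) ^ 2 := by
  have hq' := norm_neg_lt_one hq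
  have hq2 := norm_neg_lt_one (norm_sq_lt_one hq)
  have h1 := (hasSum_nomeTheta_mul hq hq').add (hasSum_nomeTheta_mul hq' hq)
  have h2 := h1.comp_add_sub ?_
  · have h3 := ((hasSum_nomeTheta_mul hq2 hq2).mul_left 2)
    have h4 : nomeTheta q * nomeTheta (-q) + nomeTheta (-q) * nomeTheta q =
        2 * (nomeTheta (-q ^ 2) * nomeTheta (-q ^ 2)) := by
      refine h2.unique (h3.of_forall_eq fun a => ?_)
      simp only [neg_pow_natAbs_sq]
      have e : Even ((a.1 + a.2).natAbs + (a.1 - a.2).natAbs) := by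
        rw [Nat.even_iff]; omega
      have e' : Even ((a.1 - a.2).natAbs + (a.1.natAbs + a.2.natAbs)) := by
        rw [Nat.even_iff]; omega
      have e2 := e.neg_one_pow (α := ℂ)
      have e4 := e'.neg_one_pow (α := ℂ)
      rw [pow_add] at e2
      rw [pow_add, pow_add] at e4
      have e3 := congrArg (fun k => q ^ k) (natAbs_add_sq_add_natAbs_sub_sq a.1 a.2)
      simp only [pow_add, pow_mul] at e3
      rcases neg_one_pow_eq_or ℂ (a.1 - a.2).natAbs with h | h <;> rw [h] at e2 e4 ⊢ 
      · linear_combination 2 * e3 + q ^ ((a.1 + a.2).natAbs ^ 2) * q ^ ((a.1 - a.2).natAbs ^ 2) * e2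
          - 2 * (q ^ 2) ^ (a.1.natAbs ^ 2) * (q ^ 2) ^ (a.2.natAbs ^ 2) * e4
      · linear_combination -2 * e3 - q ^ ((a.1 + a.2).natAbs ^ 2) * q ^ ((a.1 - a.2).natAbs ^ 2) * e2
          + 2 * (q ^ 2) ^ (a.1.natAbs ^ 2) * (q ^ 2) ^ (a.2.natAbs ^ 2) * e4
    linear_combination h4 / 2
  · intro m n hmn
    simp only [neg_pow_natAbs_sq]
    have e : Odd (m.natAbs + n.natAbs) := by
      rw [Int.odd_iff] at hmn
      rw [Nat.odd_iff]; omega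
    have e2 := e.neg_one_pow (α := ℂ)
    rw [pow_add] at e2
    rcases neg_one_pow_eq_or ℂ m.natAbs with h | h <;> rw [h] at e2 ⊢ 
    · linear_combination q ^ (m.natAbs ^ 2) * q ^ (n.natAbs ^ 2) * e2
    · linear_combination -q ^ (m.natAbs ^ 2) * q ^ (n.natAbs ^ 2) * e2

theorem tendsto_pow_two_pow {q : ℂ} (hq : ‖q‖ < 1) :
    Tendsto (fun n : ℕ => q ^ 2 ^ n) atTop (𝓝 0) :=
  (tendsto_pow_atTop_nhds_zero_of_norm_lt_one hq).comp
    (tendsto_pow_atTop_atTop_of_one_lt one_lt_two)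

theorem norm_pow_two_pow_lt_one {q : ℂ} (hq : ‖q‖ < 1) (n : ℕ) : ‖q ^ 2 ^ n‖ < 1 := by
  rw [norm_pow]
  exact pow_lt_one₀ (norm_nonneg _) hq (by positivity)

theorem continuousAt_nomeTheta_zero : ContinuousAt nomeTheta 0 :=
  (differentiableAt_nomeTheta (by simp)).continuousAt

/-- A zero at -q would propagate to every -q^(2^n), which tends to 0, where the value is 1. -/
theorem nomeTheta_neg_ne_zero {q : ℂ} (hq : ‖q‖ < 1) : nomeTheta (-q) ≠ 0 := by
  intro h
  have h1 : ∀ n : ℕ, nomeTheta (-q ^ 2 ^ n) = 0 := by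
    intro n
    induction n with
    | zero => simpa using h
    | succ n ih =>
      have := nomeTheta_mul_nomeTheta_neg (norm_pow_two_pow_lt_one hq n)
      rw [ih, mul_zero, ← pow_mul, ← pow_succ] at this
      exact pow_eq_zero_iff two_ne_zero |>.1 this.symm
  have h2 : Tendsto (fun n : ℕ => nomeTheta (-q ^ 2 ^ n)) atTop (𝓝 (nomeTheta 0)) :=
    continuousAt_nomeTheta_zero.tendsto.comp (by simpa using (tendsto_pow_two_pow hq).neg)
  simp only [h1, nomeTheta_zero] at h2
  exact zero_ne_one (tendsto_nhds_unique tendsto_const_nhds h2)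

theorem nomeTheta_ne_zero {q : ℂ} (hq : ‖q‖ < 1) : nomeTheta q ≠ 0 := by
  simpa using nomeTheta_neg_ne_zero (norm_neg_lt_one hq)

theorem theta3_eq_nomeTheta (x : ℂ) : theta3 x = nomeTheta (Complex.exp (-Real.pi * x)) := by
  refine tsum_congr fun n => ?_
  rw [← Complex.exp_nat_mul]
  congr 1
  have : ((n.natAbs : ℂ)) ^ 2 = (n : ℂ) ^ 2 := by
    rw [← Int.cast_natCast, ← Int.cast_pow, Int.natAbs_sq, Int.cast_pow]
  push_cast
  rw [this]
  ring

theorem norm_exp_neg_pi_mul_lt_one {x : ℂ} (hx : 0 < x.re) : ‖Complex.exp (-Real.pi * x)‖ < 1 := by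
  rw [Complex.norm_exp, Real.exp_lt_one_iff]
  simp only [Complex.mul_re, Complex.neg_re, Complex.ofReal_re, Complex.neg_im, Complex.ofReal_im]
  nlinarith [Real.pi_pos]

theorem theta3_ne_zero {x : ℂ} (hx : 0 < x.re) : theta3 x ≠ 0 := by
  rw [theta3_eq_nomeTheta]
  exact nomeTheta_ne_zero (norm_exp_neg_pi_mul_lt_one hx)

/-! ### The differential equation in the nome -/

/-- The logarithmic derivative `q ϑ'(q) / ϑ(q)` of the theta constant in the nome. -/
noncomputable def logDerivTheta (q : ℂ) : ℂ := q * deriv nomeTheta q / nomeTheta q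

theorem hasDerivAt_nomeTheta {q : ℂ} (hq : ‖q‖ < 1) :
    HasDerivAt nomeTheta (deriv nomeTheta q) q := (differentiableAt_nomeTheta hq).hasDerivAt

theorem hasDerivAt_nomeTheta_neg {q : ℂ} (hq : ‖q‖ < 1) :
    HasDerivAt (fun q => nomeTheta (-q)) (-deriv nomeTheta (-q)) q := by
  exact ((hasDerivAt_nomeTheta (norm_neg_lt_one hq)).comp q (hasDerivAt_neg q)).congr_deriv (by ring)

theorem mul_deriv_nomeTheta {q : ℂ} (hq : ‖q‖ < 1) :
    q * deriv nomeTheta q = logDerivTheta q * nomeTheta q := by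
  rw [logDerivTheta, div_mul_cancel₀ _ (nomeTheta_ne_zero hq)]

theorem differentiableAt_logDerivTheta {q : ℂ} (hq : ‖q‖ < 1) :
    DifferentiableAt ℂ logDerivTheta q :=
  (differentiableAt_id.mul (analyticOnNhd_nomeTheta.deriv q hq).differentiableAt).div
    (differentiableAt_nomeTheta hq) (nomeTheta_ne_zero hq)

theorem eventually_norm_lt_one {q : ℂ} (hq : ‖q‖ < 1) : ∀ᶠ w in 𝓝 q, ‖w‖ < 1 :=
  isOpen_norm_lt_one.mem_nhds hq

theorem logDerivTheta_zero : logDerivTheta 0 = 0 := by simp [logDerivTheta]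

theorem hasDerivAt_logDerivTheta_zero : HasDerivAt logDerivTheta 2 0 := by
  have h := (hasDerivAt_id (0 : ℂ)).mul
    (analyticOnNhd_nomeTheta.deriv 0 (by simp)).differentiableAt.hasDerivAt
  have h2 := h.div (hasDerivAt_nomeTheta (q := 0) (by simp)) (nomeTheta_ne_zero (by simp))
  exact h2.congr_deriv (by simp [nomeTheta_zero, deriv_nomeTheta_zero])

theorem nomeTheta_sq_mul_logDerivTheta {q : ℂ} (hq : ‖q‖ < 1) :
    nomeTheta q ^ 2 * logDerivTheta q + nomeTheta (-q) ^ 2 * logDerivTheta (-q) =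
      4 * nomeTheta (q ^ 2) ^ 2 * logDerivTheta (q ^ 2) := by
  have hl := ((hasDerivAt_nomeTheta hq).pow 2).add ((hasDerivAt_nomeTheta_neg hq).pow 2)
  have hr := ((((hasDerivAt_nomeTheta (norm_sq_lt_one hq)).comp q (hasDerivAt_pow 2 q)).pow 2).const_mul 2)
  have he := hl.unique (hr.congr_of_eventuallyEq
    ((eventually_norm_lt_one hq).mono fun w hw => nomeTheta_sq_add_sq hw))
  have h1 := mul_deriv_nomeTheta hq
  have h2 := mul_deriv_nomeTheta (norm_neg_lt_one hq)
  have h3 := mul_deriv_nomeTheta (norm_sq_lt_one hq)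
  simp only [Function.comp_apply] at he
  norm_num at he
  linear_combination q / 2 * he - nomeTheta q * h1 - nomeTheta (-q) * h2
    + 4 * nomeTheta (q ^ 2) * h3

theorem logDerivTheta_add_neg {q : ℂ} (hq : ‖q‖ < 1) :
    logDerivTheta q + logDerivTheta (-q) = 4 * logDerivTheta (-q ^ 2) := by
  have hq2 := norm_neg_lt_one (norm_sq_lt_one hq)
  have hl := (hasDerivAt_nomeTheta hq).mul (hasDerivAt_nomeTheta_neg hq)
  have hr := (((hasDerivAt_nomeTheta hq2).comp q (hasDerivAt_pow 2 q).neg).pow 2)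
  have he := hl.unique (hr.congr_of_eventuallyEq
    ((eventually_norm_lt_one hq).mono fun w hw => nomeTheta_mul_nomeTheta_neg hw))
  have h1 := mul_deriv_nomeTheta hq
  have h2 := mul_deriv_nomeTheta (norm_neg_lt_one hq)
  have h3 := mul_deriv_nomeTheta hq2
  have h4 := nomeTheta_mul_nomeTheta_neg hq
  simp only [Function.comp_apply, Pi.neg_apply] at he
  norm_num at he
  refine mul_left_cancel₀ (mul_ne_zero (nomeTheta_ne_zero hq) (nomeTheta_neg_ne_zero hq)) ?_
  linear_combination q * he - nomeTheta (-q) * h1 - nomeTheta q * h2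
    + 4 * nomeTheta (-q ^ 2) * h3 - 4 * logDerivTheta (-q ^ 2) * h4

/-- Landen's identity for θ₂: with A = θ₃² and B = θ₄² at q, it reads ((A + B)/2)² - AB = ((A -
B)/2)². -/
theorem nomeTheta_pow_four_sub_sq {q : ℂ} (hq : ‖q‖ < 1) :
    nomeTheta (q ^ 2) ^ 4 - nomeTheta (-q ^ 2) ^ 4 =
      ((nomeTheta q ^ 2 - nomeTheta (-q) ^ 2) / 2) ^ 2 := by
  have h1 := nomeTheta_sq_add_sq hq
  have h2 := nomeTheta_mul_nomeTheta_neg hq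
  have e1 : nomeTheta (q ^ 2) ^ 4 = (nomeTheta (q ^ 2) ^ 2) ^ 2 := by ring
  have e2 : nomeTheta (-q ^ 2) ^ 4 = (nomeTheta (-q ^ 2) ^ 2) ^ 2 := by ring
  rw [e1, e2, ← h2, show nomeTheta (q ^ 2) ^ 2 = (nomeTheta q ^ 2 + nomeTheta (-q) ^ 2) / 2 by
    rw [h1]; ring]
  ring

theorem hasDerivAt_nomeTheta_pow_four_sub_zero :
    HasDerivAt (fun q => nomeTheta q ^ 4 - nomeTheta (-q) ^ 4) 16 0 := by
  have h := ((hasDerivAt_nomeTheta (q := 0) (by simp)).pow 4).sub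
    ((hasDerivAt_nomeTheta_neg (q := 0) (by simp)).pow 4)
  exact h.congr_deriv (by simp [nomeTheta_zero, deriv_nomeTheta_zero]; norm_num)

theorem tendsto_pow_two_pow_ne {q : ℂ} (hq : ‖q‖ < 1) (h0 : q ≠ 0) :
    Tendsto (fun n : ℕ => q ^ 2 ^ n) atTop (𝓝[≠] 0) :=
  tendsto_nhdsWithin_iff.2 ⟨tendsto_pow_two_pow hq, .of_forall fun _ => pow_ne_zero _ h0⟩

/-- Zeros propagate from q to q^(2^n) and would accumulate at 0, which is impossible because the
derivative there is 16. -/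
theorem nomeTheta_pow_four_sub_ne_zero {q : ℂ} (hq : ‖q‖ < 1) (h0 : q ≠ 0) :
    nomeTheta q ^ 4 - nomeTheta (-q) ^ 4 ≠ 0 := by
  intro h
  have key : ∀ n : ℕ, nomeTheta (q ^ 2 ^ n) ^ 4 - nomeTheta (-q ^ 2 ^ n) ^ 4 = 0 := by
    intro n
    induction n with
    | zero => simpa using h
    | succ n ih =>
      have hn := norm_pow_two_pow_lt_one hq n
      have h1 := nomeTheta_sq_add_sq hn
      have h2 := nomeTheta_pow_four_sub_sq hn
      have h3 := nomeTheta_ne_zero (norm_sq_lt_one hn)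
      rw [pow_succ 2 n, pow_mul, h2]
      have h4 : (nomeTheta (q ^ 2 ^ n) ^ 2 - nomeTheta (-q ^ 2 ^ n) ^ 2) *
          (2 * nomeTheta ((q ^ 2 ^ n) ^ 2) ^ 2) = 0 := by
        rw [← h1]
        linear_combination ih
      rcases mul_eq_zero.1 h4 with h5 | h5
      · rw [h5]; simp
      · simp [h3] at h5
  have h1 := hasDerivAt_nomeTheta_pow_four_sub_zero.eventually_ne (c := 0) (by norm_num)
  obtain ⟨n, hn⟩ := ((tendsto_pow_two_pow_ne hq h0).eventually h1).exists
  exact hn (key n)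

theorem tendsto_logDerivTheta_sub_div :
    Tendsto (fun q => (logDerivTheta q - logDerivTheta (-q)) /
      (nomeTheta q ^ 4 - nomeTheta (-q) ^ 4)) (𝓝[≠] 0) (𝓝 (1 / 4)) := by
  have h1 : HasDerivAt (fun q => logDerivTheta q - logDerivTheta (-q)) 4 0 := by
    have := hasDerivAt_logDerivTheta_zero.sub
      ((show HasDerivAt logDerivTheta 2 (-0) by
        simpa using hasDerivAt_logDerivTheta_zero).comp 0 (hasDerivAt_neg (0 : ℂ)))
    exact this.congr_deriv (by norm_num)
  have h2 := h1.tendsto_slope.div hasDerivAt_nomeTheta_pow_four_sub_zero.tendsto_slope (by norm_num)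
  have e : (4 / 16 : ℂ) = 1 / 4 := by norm_num
  rw [e] at h2
  refine h2.congr' ?_
  filter_upwards [self_mem_nhdsWithin] with q hq
  simp only [Pi.div_apply, slope_def_field, neg_zero, sub_self, sub_zero]
  rw [div_div_div_cancel_right₀ hq]

/-- The quotient of the two differences is invariant under q ↦ q², so it equals its limit 1/4 at 0.
-/
theorem logDerivTheta_sub_neg {q : ℂ} (hq : ‖q‖ < 1) :
    logDerivTheta q - logDerivTheta (-q) = (nomeTheta q ^ 4 - nomeTheta (-q) ^ 4) / 4 := by
  rcases eq_or_ne q 0 with rfl | h0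
  · simp
  have key : ∀ n : ℕ, (logDerivTheta (q ^ 2 ^ n) - logDerivTheta (-q ^ 2 ^ n)) /
      (nomeTheta (q ^ 2 ^ n) ^ 4 - nomeTheta (-q ^ 2 ^ n) ^ 4) =
      (logDerivTheta q - logDerivTheta (-q)) / (nomeTheta q ^ 4 - nomeTheta (-q) ^ 4) := by
    intro n
    induction n with
    | zero => simp
    | succ n ih =>
      rw [← ih, pow_succ, pow_mul]
      have hn := norm_pow_two_pow_lt_one hq n
      set w := q ^ 2 ^ n with hw
      have hw0 : w ≠ 0 := pow_ne_zero _ h0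
      rw [div_eq_div_iff (nomeTheta_pow_four_sub_ne_zero (norm_sq_lt_one hn) (pow_ne_zero 2 hw0))
        (nomeTheta_pow_four_sub_ne_zero hn hw0), nomeTheta_pow_four_sub_sq hn]
      have h1 := nomeTheta_sq_add_sq hn
      have h3 := nomeTheta_ne_zero (norm_sq_lt_one hn)
      have h4 := nomeTheta_sq_mul_logDerivTheta hn
      have h5 := logDerivTheta_add_neg hn
      refine mul_left_cancel₀ (pow_ne_zero 2 h3) ?_
      linear_combination (-(nomeTheta w ^ 4 - nomeTheta (-w) ^ 4) / 4) * h4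
        + (nomeTheta (w ^ 2) ^ 2 * (nomeTheta w ^ 4 - nomeTheta (-w) ^ 4) / 4) * h5
        + ((nomeTheta w ^ 4 - nomeTheta (-w) ^ 4) / 8 * (logDerivTheta w + logDerivTheta (-w))
          + (logDerivTheta w - logDerivTheta (-w)) * (nomeTheta w ^ 2 - nomeTheta (-w) ^ 2) ^ 2 / 8) * h1
  have hlim := tendsto_logDerivTheta_sub_div.comp (tendsto_pow_two_pow_ne hq h0)
  simp only [Function.comp_def, key] at hlim
  have := tendsto_nhds_unique tendsto_const_nhds hlim
  rw [div_eq_iff (nomeTheta_pow_four_sub_ne_zero hq h0)] at this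
  rw [this]
  ring

/-- The defect G of the equation satisfies G(q) = 4 G(q²) and G(0) = 0. Since G(q^(2^n)) is of order
q^(2^n), it beats 4^n, and G vanishes. -/
theorem mul_deriv_logDerivTheta {q : ℂ} (hq : ‖q‖ < 1) :
    q * deriv logDerivTheta q = 2 * logDerivTheta q ^ 2 +
      (nomeTheta q ^ 4 - nomeTheta (-q) ^ 4) * nomeTheta (-q) ^ 4 / 8 := by
  set G : ℂ → ℂ := fun q => q * deriv logDerivTheta q - 2 * logDerivTheta q ^ 2 -
      (nomeTheta q ^ 4 - nomeTheta (-q) ^ 4) * nomeTheta (-q) ^ 4 / 8 with hG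
  have hA : ∀ {w : ℂ}, ‖w‖ < 1 → HasDerivAt (fun q => nomeTheta q ^ 4 - nomeTheta (-q) ^ 4)
      (4 * nomeTheta w ^ 3 * deriv nomeTheta w + 4 * nomeTheta (-w) ^ 3 * deriv nomeTheta (-w))
      w := by
    intro w hw
    have := ((hasDerivAt_nomeTheta hw).pow 4).sub ((hasDerivAt_nomeTheta_neg hw).pow 4)
    exact this.congr_deriv (by norm_num)
  have hA' : ∀ {w : ℂ}, ‖w‖ < 1 →
      w * (4 * nomeTheta w ^ 3 * deriv nomeTheta w + 4 * nomeTheta (-w) ^ 3 * deriv nomeTheta (-w)) =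
      (nomeTheta w ^ 4 - nomeTheta (-w) ^ 4) * (4 * logDerivTheta w + nomeTheta (-w) ^ 4) := by
    intro w hw
    have h1 := mul_deriv_nomeTheta hw
    have h2 := mul_deriv_nomeTheta (norm_neg_lt_one hw)
    have h3 := logDerivTheta_sub_neg hw
    linear_combination 4 * nomeTheta w ^ 3 * h1 - 4 * nomeTheta (-w) ^ 3 * h2
      + 4 * nomeTheta (-w) ^ 4 * h3
  -- This combination of L and θ₂⁴ transforms under doubling without reference to -w;
  -- differentiating it relates L' at w and at w².
  have hψ : ∀ {w : ℂ}, ‖w‖ < 1 →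
      4 * logDerivTheta (w ^ 2) - (nomeTheta (w ^ 2) ^ 4 - nomeTheta (-w ^ 2) ^ 4) =
      2 * logDerivTheta w - (nomeTheta w ^ 4 - nomeTheta (-w) ^ 4) / 4 := by
    intro w hw
    linear_combination 4 * logDerivTheta_sub_neg (norm_sq_lt_one hw) - logDerivTheta_sub_neg hw
      - logDerivTheta_add_neg hw
  have hG4 : ∀ {w : ℂ}, ‖w‖ < 1 → G w = 4 * G (w ^ 2) := by
    intro w hw
    have hw2 := norm_sq_lt_one hw
    have hl := (((differentiableAt_logDerivTheta hw2).hasDerivAt.comp w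
      (hasDerivAt_pow 2 w)).const_mul 4).sub ((hA hw2).comp w (hasDerivAt_pow 2 w))
    have hr := ((differentiableAt_logDerivTheta hw).hasDerivAt.const_mul 2).sub
      ((hA hw).div_const 4)
    have he := hl.unique (hr.congr_of_eventuallyEq
      ((eventually_norm_lt_one hw).mono fun w hw => hψ hw))
    have h1 := hA' hw
    have h2 := hA' hw2
    have h3 := nomeTheta_pow_four_sub_sq hw
    have h4 := hψ hw
    have h5 := nomeTheta_mul_nomeTheta_neg hw
    norm_num at he
    have he' : 8 * (w ^ 2 * deriv logDerivTheta (w ^ 2)) -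
        2 * ((nomeTheta (w ^ 2) ^ 4 - nomeTheta (-w ^ 2) ^ 4) *
          (4 * logDerivTheta (w ^ 2) + nomeTheta (-w ^ 2) ^ 4)) =
        2 * (w * deriv logDerivTheta w) -
        (nomeTheta w ^ 4 - nomeTheta (-w) ^ 4) * (4 * logDerivTheta w + nomeTheta (-w) ^ 4) / 4 := by
      rw [← h1, ← h2]
      linear_combination w * he
    have h6 : nomeTheta (-w ^ 2) ^ 4 = nomeTheta w ^ 2 * nomeTheta (-w) ^ 2 := by
      rw [← mul_pow, h5]; ring
    have h7 : logDerivTheta (w ^ 2) = (((nomeTheta w ^ 2 - nomeTheta (-w) ^ 2) / 2) ^ 2 +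
        2 * logDerivTheta w - (nomeTheta w ^ 4 - nomeTheta (-w) ^ 4) / 4) / 4 := by
      linear_combination h4 / 4 + h3 / 4
    simp only [hG]
    rw [h3, h6, h7] at he' ⊢
    linear_combination -he' / 2
  have hGn : ∀ n : ℕ, G q = 4 ^ n * G (q ^ 2 ^ n) := by
    intro n
    induction n with
    | zero => simp
    | succ n ih =>
      rw [ih, hG4 (norm_pow_two_pow_lt_one hq n), pow_succ 2 n, pow_mul]
      ring
  have hanalytic : AnalyticAt ℂ logDerivTheta 0 :=
    DifferentiableOn.analyticAt (s := {q : ℂ | ‖q‖ < 1})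
      (fun _ hq => (differentiableAt_logDerivTheta hq).differentiableWithinAt)
      (eventually_norm_lt_one (by simp))
  have hGd : DifferentiableAt ℂ G 0 := by
    have h1 := hanalytic.deriv.differentiableAt
    have h2 := hanalytic.differentiableAt
    have h3 := differentiableAt_nomeTheta (q := 0) (by simp)
    have h4 := (hasDerivAt_nomeTheta_neg (q := 0) (by simp)).differentiableAt
    simp only [hG]
    fun_prop
  have hG0 : G 0 = 0 := by simp [hG, logDerivTheta_zero]
  have hO := hGd.hasDerivAt.isBigO_sub.comp_tendsto (tendsto_pow_two_pow hq)
  simp only [hG0, sub_zero, Function.comp_def] at hO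
  have hlim : Tendsto (fun n : ℕ => (4 : ℂ) ^ n * G (q ^ 2 ^ n)) atTop (𝓝 0) := by
    refine ((Asymptotics.isBigO_refl (fun n : ℕ => (4 : ℂ) ^ n) atTop).mul hO).trans_tendsto ?_
    rw [tendsto_zero_iff_norm_tendsto_zero]
    have h1 := (tendsto_pow_const_mul_const_pow_of_abs_lt_one 2
      (r := ‖q‖) (by rwa [abs_norm])).comp (tendsto_pow_atTop_atTop_of_one_lt (one_lt_two (α := ℕ)))
    refine h1.congr fun n => ?_
    simp only [Function.comp_apply, norm_mul, norm_pow]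
    push_cast
    rw [← pow_mul, mul_comm n 2, pow_mul]
    norm_num
  have hGq : G q = 0 :=
    tendsto_nhds_unique (tendsto_const_nhds (f := atTop (α := ℕ))) (hlim.congr fun n => (hGn n).symm)
  simp only [hG] at hGq
  linear_combination hGq

/-! ### Modularity of θ₃ and evenness of σ₃ -/

theorem Complex.mul_cpow_of_re_pos {x y : ℂ} (hx : 0 < x.re) (hy : 0 < y.re) (c : ℂ) :
    (x * y) ^ c = x ^ c * y ^ c := by
  have hx0 : x ≠ 0 := by rintro rfl; simp at hx
  have hy0 : y ≠ 0 := by rintro rfl; simp at hy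
  have h1 := abs_lt.1 (Complex.abs_arg_lt_pi_div_two_iff.2 (Or.inl hx))
  have h2 := abs_lt.1 (Complex.abs_arg_lt_pi_div_two_iff.2 (Or.inl hy))
  rw [Complex.cpow_def_of_ne_zero hx0, Complex.cpow_def_of_ne_zero hy0,
    Complex.cpow_def_of_ne_zero (mul_ne_zero hx0 hy0),
    Complex.log_mul hx0 hy0 ⟨by linarith [h1.1, h2.1], by linarith [h1.2, h2.2]⟩, add_mul,
    Complex.exp_add]

theorem theta3_one_div {x : ℂ} (hx : 0 < x.re) :
    theta3 (1 / x) = x ^ (1 / 2 : ℂ) * theta3 x := by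
  have key : ∀ y : ℂ, theta3 y = jacobiTheta (Complex.I * y) := by
    intro y
    refine tsum_congr fun n => ?_
    congr 1
    linear_combination (-(Real.pi : ℂ) * n ^ 2 * y) * Complex.I_sq
  have hx0 : x ≠ 0 := by rintro rfl; simp at hx
  have h := jacobiTheta_S_smul ⟨Complex.I * x, by simpa using hx⟩
  rw [UpperHalfPlane.modular_S_smul] at h
  simp only at h
  rw [key, key]
  convert h using 2
  · field_simp
    simp
  · rw [← mul_assoc, neg_mul, Complex.I_mul_I, neg_neg, one_mul]

theorem one_add_re_pos {z : ℂ} (hz : ‖z‖ < 1) : 0 < (1 + z).re := by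
  have := neg_abs_le z.re
  have := Complex.abs_re_le_norm z
  simp only [Complex.add_re, Complex.one_re]
  linarith

theorem one_add_ne_zero {z : ℂ} (hz : ‖z‖ < 1) : 1 + z ≠ 0 := by
  intro h
  have := one_add_re_pos hz
  simp [h] at this

theorem one_sub_div_one_add_re_pos {z : ℂ} (hz : ‖z‖ < 1) : 0 < ((1 - z) / (1 + z)).re := by
  have h := one_add_ne_zero hz
  rw [Complex.div_re, ← add_div]
  refine div_pos ?_ (Complex.normSq_pos.2 h)
  have h2 : Complex.normSq z < 1 := by
    rw [Complex.normSq_eq_norm_sq]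
    exact pow_lt_one₀ (norm_nonneg _) hz two_ne_zero
  rw [Complex.normSq_apply] at h2
  simp only [Complex.sub_re, Complex.add_re, Complex.one_re, Complex.sub_im, Complex.add_im,
    Complex.one_im]
  nlinarith

/-- In the coordinate x = (1 - z)/(1 + z) the sign change is x ↦ 1/x, and the factor √x is absorbed
through 1 - z = (1 + z)x. -/
theorem sigma3_neg {z : ℂ} (hz : ‖z‖ < 1) : sigma3 (-z) = sigma3 z := by
  have h1 := one_add_re_pos hz
  have h2 := one_sub_div_one_add_re_pos hz
  have h3 := one_add_ne_zero hz
  have h4 := one_add_ne_zero (norm_neg_lt_one hz)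
  have e1 : (1 - -z) / (1 + -z) = 1 / ((1 - z) / (1 + z)) := by
    rw [one_div_div, sub_neg_eq_add, ← sub_eq_add_neg]
  have e2 : 1 + -z = (1 + z) * ((1 - z) / (1 + z)) := by
    rw [mul_div_cancel₀ _ h3, sub_eq_add_neg]
  rw [sigma3, sigma3, e1, theta3_one_div h2, e2, Complex.mul_cpow_of_re_pos h1 h2,
    Complex.cpow_neg ((1 - z) / (1 + z))]
  have h5 : ((1 - z) / (1 + z)) ^ (1 / 2 : ℂ) ≠ 0 := by
    rw [Ne, Complex.cpow_eq_zero_iff, not_and_or]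
    left
    intro h
    simp [h] at h2
  field_simp

/-! ### The autonomous system in the disk coordinate -/

/-- The nome at the point `x = (1 - z) / (1 + z)` of the right half-plane. -/
noncomputable def diskNome (z : ℂ) : ℂ := Complex.exp (-Real.pi * ((1 - z) / (1 + z)))

theorem norm_diskNome_lt_one {z : ℂ} (hz : ‖z‖ < 1) : ‖diskNome z‖ < 1 :=
  norm_exp_neg_pi_mul_lt_one (one_sub_div_one_add_re_pos hz)

theorem hasDerivAt_diskNome {z : ℂ} (hz : ‖z‖ < 1) :
    HasDerivAt diskNome (2 * Real.pi / (1 + z) ^ 2 * diskNome z) z := by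
  have h3 := one_add_ne_zero hz
  have h := ((((hasDerivAt_id z).const_sub 1).div ((hasDerivAt_id z).const_add 1) h3).const_mul
    (-(Real.pi : ℂ))).cexp
  refine h.congr_deriv ?_
  simp only [diskNome, Pi.div_apply, id]
  field_simp
  ring

theorem sigma3_eq (z : ℂ) : sigma3 z = (1 + z) ^ (-(1 / 2) : ℂ) * nomeTheta (diskNome z) := by
  rw [sigma3, theta3_eq_nomeTheta, diskNome]

theorem sigma3_zero : sigma3 0 = theta3 1 := by simp [sigma3]

theorem sigma3_ne_zero {z : ℂ} (hz : ‖z‖ < 1) : sigma3 z ≠ 0 := by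
  rw [sigma3_eq]
  refine mul_ne_zero ?_ (nomeTheta_ne_zero (norm_diskNome_lt_one hz))
  rw [Ne, Complex.cpow_eq_zero_iff, not_and_or]
  exact Or.inl (one_add_ne_zero hz)

theorem sigma3_pow_four {z : ℂ} :
    sigma3 z ^ 4 = nomeTheta (diskNome z) ^ 4 / (1 + z) ^ 2 := by
  rw [sigma3_eq, mul_pow, ← Complex.cpow_nat_mul]
  have : ((4 : ℕ) : ℂ) * (-(1 / 2)) = -(2 : ℕ) := by norm_num
  rw [this, Complex.cpow_neg, Complex.cpow_natCast]
  ring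

/-- The logarithmic derivative of `sigma3`. -/
noncomputable def logDerivSigma (z : ℂ) : ℂ :=
  -1 / (2 * (1 + z)) + 2 * Real.pi * logDerivTheta (diskNome z) / (1 + z) ^ 2

/-- The Hauptmodul `(θ₂⁴ - θ₄⁴) / θ₃⁴` in the disk coordinate. -/
noncomputable def diskModulus (z : ℂ) : ℂ :=
  1 - 2 * (nomeTheta (-diskNome z) ^ 4 / nomeTheta (diskNome z) ^ 4)

theorem hasDerivAt_sigma3 {z : ℂ} (hz : ‖z‖ < 1) :
    HasDerivAt sigma3 (logDerivSigma z * sigma3 z) z := by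
  have h3 := one_add_ne_zero hz
  have hq := norm_diskNome_lt_one hz
  have h1 := ((hasDerivAt_id z).const_add 1).cpow_const (c := -(1 / 2))
    (Complex.mem_slitPlane_of_norm_lt_one hz)
  have h := h1.mul ((hasDerivAt_nomeTheta hq).comp z (hasDerivAt_diskNome hz))
  have e : sigma3 = _ := funext sigma3_eq
  rw [e]
  refine h.congr_deriv ?_
  have h4 := mul_deriv_nomeTheta hq
  have h5 : -1 / (2 * (1 + z)) = -(1 / 2) / (1 + z) := by field_simp
  simp only [Function.comp_apply, id, Complex.cpow_sub _ _ h3, Complex.cpow_one, logDerivSigma, h5]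
  linear_combination (1 + z) ^ (-(1 / 2) : ℂ) * (2 * Real.pi / (1 + z) ^ 2) * h4

theorem one_sub_diskModulus_sq {z : ℂ} (hz : ‖z‖ < 1) :
    (1 - diskModulus z ^ 2) * nomeTheta (diskNome z) ^ 8 =
      4 * (nomeTheta (diskNome z) ^ 4 - nomeTheta (-diskNome z) ^ 4) *
        nomeTheta (-diskNome z) ^ 4 := by
  have h := nomeTheta_ne_zero (norm_diskNome_lt_one hz)
  rw [diskModulus]
  field_simp
  ring

/-- This is `mul_deriv_logDerivTheta` after the change of variable. The summand -1/(2(1 + z)) of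
`logDerivSigma` is what removes every explicit power of 1 + z. -/
theorem hasDerivAt_logDerivSigma {z : ℂ} (hz : ‖z‖ < 1) :
    HasDerivAt logDerivSigma (2 * logDerivSigma z ^ 2 +
      Real.pi ^ 2 / 8 * (1 - diskModulus z ^ 2) * sigma3 z ^ 8) z := by
  have h3 := one_add_ne_zero hz
  have hq := norm_diskNome_lt_one hz
  have hid := (hasDerivAt_id z).const_add 1
  have h1 := (hasDerivAt_const z (-1 : ℂ)).div (hid.const_mul 2) (mul_ne_zero two_ne_zero h3)
  have h2 := (((differentiableAt_logDerivTheta hq).hasDerivAt.comp z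
    (hasDerivAt_diskNome hz)).const_mul (2 * (Real.pi : ℂ))).div (hid.pow 2) (pow_ne_zero 2 h3)
  refine (h1.add h2).congr_deriv ?_
  have h4 := mul_deriv_logDerivTheta hq
  have h5 := one_sub_diskModulus_sq hz
  rw [show sigma3 z ^ 8 = (sigma3 z ^ 4) ^ 2 by ring, sigma3_pow_four, logDerivSigma]
  simp only [Function.comp_apply, id, Pi.pow_apply]
  field_simp
  push_cast
  linear_combination 64 * (Real.pi : ℂ) ^ 2 * h4 - 2 * (Real.pi : ℂ) ^ 2 * h5

theorem hasDerivAt_diskModulus {z : ℂ} (hz : ‖z‖ < 1) :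
    HasDerivAt diskModulus (Real.pi * (1 - diskModulus z ^ 2) * sigma3 z ^ 4) z := by
  have h3 := one_add_ne_zero hz
  have hq := norm_diskNome_lt_one hz
  have h0 := nomeTheta_ne_zero hq
  have hn := hasDerivAt_diskNome hz
  have h := (((((hasDerivAt_nomeTheta_neg hq).comp z hn).pow 4).div
    (((hasDerivAt_nomeTheta hq).comp z hn).pow 4) (pow_ne_zero 4 h0)).const_mul 2).const_sub 1
  refine h.congr_deriv ?_
  have h4 := mul_deriv_nomeTheta hq
  have h5 := mul_deriv_nomeTheta (norm_neg_lt_one hq)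
  have h6 := logDerivTheta_sub_neg hq
  have h7 := one_sub_diskModulus_sq hz
  rw [sigma3_pow_four, eq_div_of_mul_eq (pow_ne_zero 8 h0) h7]
  simp only [Function.comp_apply, Pi.pow_apply]
  field_simp
  push_cast
  linear_combination 16 * nomeTheta (-diskNome z) ^ 4 * nomeTheta (diskNome z) ^ 3 * h4
    - 16 * nomeTheta (-diskNome z) ^ 3 * nomeTheta (diskNome z) ^ 4 * h5
    + 16 * nomeTheta (-diskNome z) ^ 4 * nomeTheta (diskNome z) ^ 4 * h6

theorem logDerivSigma_neg {z : ℂ} (hz : ‖z‖ < 1) : logDerivSigma (-z) = -logDerivSigma z := by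
  have hl := (hasDerivAt_sigma3 (norm_neg_lt_one hz)).comp z (hasDerivAt_neg z)
  have he := hl.unique ((hasDerivAt_sigma3 hz).congr_of_eventuallyEq
    ((eventually_norm_lt_one hz).mono fun w hw => sigma3_neg hw))
  rw [sigma3_neg hz] at he
  refine mul_right_cancel₀ (sigma3_ne_zero hz) ?_
  linear_combination -he

theorem logDerivSigma_zero : logDerivSigma 0 = 0 := by
  have h := logDerivSigma_neg (z := 0) (by simp)
  rw [neg_zero] at h
  linear_combination h / 2

theorem one_sub_diskModulus_sq_ne_zero {z : ℂ} (hz : ‖z‖ < 1) : 1 - diskModulus z ^ 2 ≠ 0 := by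
  intro h
  have h1 := one_sub_diskModulus_sq hz
  have hq := norm_diskNome_lt_one hz
  have h2 := nomeTheta_pow_four_sub_ne_zero hq (Complex.exp_ne_zero _)
  have h3 := nomeTheta_neg_ne_zero hq
  rw [h, zero_mul] at h1
  simp [h2, h3] at h1

/-- The logarithmic derivative is odd, so its derivative is even; in `hasDerivAt_logDerivSigma`
every other ingredient is already known to be even. -/
theorem diskModulus_neg_sq {z : ℂ} (hz : ‖z‖ < 1) : diskModulus (-z) ^ 2 = diskModulus z ^ 2 := by
  have hl := (hasDerivAt_logDerivSigma (norm_neg_lt_one hz)).comp z (hasDerivAt_neg z)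
  have he := hl.unique ((hasDerivAt_logDerivSigma hz).neg.congr_of_eventuallyEq
    ((eventually_norm_lt_one hz).mono fun w hw => logDerivSigma_neg hw))
  rw [sigma3_neg hz, logDerivSigma_neg hz] at he
  have h1 : (Real.pi : ℂ) ^ 2 / 8 * sigma3 z ^ 8 ≠ 0 := by
    simp [sigma3_ne_zero hz, Real.pi_ne_zero]
  refine mul_left_cancel₀ h1 ?_
  linear_combination he

/-- Differentiating the even function m² at 0 gives m(0) m'(0) = 0, and m'(0) ≠ 0. -/
theorem diskModulus_zero : diskModulus 0 = 0 := by
  have h0 : ‖(0 : ℂ)‖ < 1 := by simp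
  have h := hasDerivAt_diskModulus h0
  have hn := hasDerivAt_diskModulus (norm_neg_lt_one h0)
  have he := ((hn.comp 0 (hasDerivAt_neg 0)).pow 2).unique ((h.pow 2).congr_of_eventuallyEq
    ((eventually_norm_lt_one h0).mono fun w hw => diskModulus_neg_sq hw))
  simp only [neg_zero, Function.comp_apply, Nat.cast_ofNat] at he
  have h1 : Real.pi * (1 - diskModulus 0 ^ 2) * sigma3 0 ^ 4 ≠ 0 :=
    mul_ne_zero (mul_ne_zero (by exact_mod_cast Real.pi_ne_zero)
      (one_sub_diskModulus_sq_ne_zero h0)) (pow_ne_zero 4 (sigma3_ne_zero h0))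
  refine mul_right_cancel₀ h1 ?_
  linear_combination -he / 4

theorem differentiableOn_sigma3 : DifferentiableOn ℂ sigma3 (Metric.ball 0 1) := fun _ hz =>
  (hasDerivAt_sigma3 (by simpa using hz)).differentiableAt.differentiableWithinAt

/-! ### Integrality of the derivatives -/

/-- A solution of the autonomous integral system `s' = Ps`, `P' = 2P² + (1 - 2T²)s⁸`,
`T' = 2(1 - 2T²)s⁴`, with time scaled by `c` and integral initial values, has integral derivatives
up to powers of `c`. -/
theorem exists_int_iteratedDeriv_eq {s P T : ℂ → ℂ} {c : ℂ} {U : Set ℂ} (hU : IsOpen U)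
    (h0 : 0 ∈ U)
    (hs : ∀ z ∈ U, HasDerivAt s (c * (P z * s z)) z)
    (hP : ∀ z ∈ U, HasDerivAt P (c * (2 * P z ^ 2 + (1 - 2 * T z ^ 2) * s z ^ 8)) z)
    (hT : ∀ z ∈ U, HasDerivAt T (c * (2 * (1 - 2 * T z ^ 2) * s z ^ 4)) z)
    (hs0 : s 0 = 1) (hP0 : P 0 = 0) (hT0 : T 0 = 0) (n : ℕ) :
    ∃ k : ℤ, iteratedDeriv n s 0 = c ^ n * k := by
  -- The ring of integer polynomials in s, P, T is stable under c⁻¹ d/dz on U, and evaluation at 0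
  -- maps it to ℤ.
  set R : Subring (ℂ → ℂ) := Subring.closure {s, P, T} with hR
  have hsR : s ∈ R := Subring.subset_closure (by simp)
  have hPR : P ∈ R := Subring.subset_closure (by simp)
  have hTR : T ∈ R := Subring.subset_closure (by simp)
  have h2R : (2 : ℂ → ℂ) ∈ R := ofNat_mem R 2
  have hderiv : ∀ g ∈ R, ∃ g' ∈ R, ∀ z ∈ U, HasDerivAt g (c * g' z) z := by
    intro g hg
    induction hg using Subring.closure_induction with
    | mem g hg =>
      simp only [Set.mem_insert_iff, Set.mem_singleton_iff] at hg
      have h3 : (1 - 2 * T ^ 2) ∈ R := sub_mem (one_mem R) (mul_mem h2R (pow_mem hTR 2))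
      rcases hg with rfl | rfl | rfl
      · exact ⟨P * g, mul_mem hPR hsR, hs⟩
      · exact ⟨2 * g ^ 2 + (1 - 2 * T ^ 2) * s ^ 8,
          add_mem (mul_mem h2R (pow_mem hPR 2)) (mul_mem h3 (pow_mem hsR 8)), hP⟩
      · exact ⟨2 * (1 - 2 * g ^ 2) * s ^ 4, mul_mem (mul_mem h2R h3) (pow_mem hsR 4), hT⟩
    | zero => exact ⟨0, zero_mem R, fun z _ => (hasDerivAt_const z (0 : ℂ)).congr_deriv (by simp)⟩
    | one => exact ⟨0, zero_mem R, fun z _ => (hasDerivAt_const z (1 : ℂ)).congr_deriv (by simp)⟩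
    | add f g _ _ hf hg =>
      obtain ⟨f', hfR, hf⟩ := hf
      obtain ⟨g', hgR, hg⟩ := hg
      exact ⟨f' + g', add_mem hfR hgR, fun z hz =>
        ((hf z hz).add (hg z hz)).congr_deriv (by simp [mul_add])⟩
    | neg f _ hf =>
      obtain ⟨f', hfR, hf⟩ := hf
      exact ⟨-f', neg_mem hfR, fun z hz => (hf z hz).neg.congr_deriv (by simp)⟩
    | mul f g hfm hgm hf hg =>
      obtain ⟨f', hfR, hf⟩ := hf
      obtain ⟨g', hgR, hg⟩ := hg
      exact ⟨f' * g + f * g', add_mem (mul_mem hfR hgm) (mul_mem hfm hgR), fun z hz =>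
        ((hf z hz).mul (hg z hz)).congr_deriv (by simp; ring)⟩
  have hiter : ∀ n : ℕ, ∃ g ∈ R, ∀ z ∈ U, iteratedDeriv n s z = c ^ n * g z := by
    intro n
    induction n with
    | zero => exact ⟨s, hsR, fun z _ => by simp⟩
    | succ n ih =>
      obtain ⟨g, hg, hgz⟩ := ih
      obtain ⟨g', hg', hgz'⟩ := hderiv g hg
      refine ⟨g', hg', fun z hz => ?_⟩
      have he : iteratedDeriv n s =ᶠ[𝓝 z] fun z => c ^ n * g z :=
        eventually_of_mem (hU.mem_nhds hz) hgz
      rw [iteratedDeriv_succ, he.deriv_eq, ((hgz' z hz).const_mul _).deriv]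
      ring
  obtain ⟨g, hg, hgz⟩ := hiter n
  have hint : R ≤ (Int.castRingHom ℂ).range.comap (Pi.evalRingHom (fun _ : ℂ => ℂ) 0) := by
    rw [hR, Subring.closure_le]
    rintro f (rfl | rfl | rfl)
    · exact ⟨1, by simp [hs0]⟩
    · exact ⟨0, by simp [hP0]⟩
    · exact ⟨0, by simp [hT0]⟩
  obtain ⟨k, hk⟩ := hint hg
  refine ⟨k, ?_⟩
  rw [hgz 0 h0]
  congr 1
  simpa using hk.symm

theorem exists_int_iteratedDeriv_sigma3 (n : ℕ) :
    ∃ k : ℤ, iteratedDeriv (2 * n) sigma3 0 =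
      theta3 1 * ((Real.pi ^ 2 * theta3 1 ^ 8 / 8) ^ n * k) := by
  have hθ : theta3 1 ≠ 0 := theta3_ne_zero (by simp)
  have hπ : (Real.pi : ℂ) ≠ 0 := by exact_mod_cast Real.pi_ne_zero
  -- Dividing m by r = √2 and the logarithmic derivative by c makes all coefficients integral. Only
  -- c² enters the even derivatives, so the choice of root is immaterial.
  obtain ⟨r, hr⟩ : ∃ r : ℂ, r ^ 2 = 2 := IsAlgClosed.exists_pow_nat_eq 2 two_pos
  have hr0 : r ≠ 0 := by rintro rfl; norm_num at hr
  set c := Real.pi * theta3 1 ^ 4 * r / 4 with hc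
  have hc0 : c ≠ 0 := by
    simp [hc, hθ, hπ, hr0]
  have hc2 : c ^ 2 = Real.pi ^ 2 * theta3 1 ^ 8 / 8 := by
    rw [hc, div_pow, mul_pow, hr]; ring
  obtain ⟨k, hk⟩ := exists_int_iteratedDeriv_eq (s := fun z => (theta3 1)⁻¹ * sigma3 z)
    (P := fun z => logDerivSigma z / c) (T := fun z => diskModulus z / r) (c := c)
    isOpen_norm_lt_one (by simp)
    (fun z hz => ((hasDerivAt_sigma3 hz).const_mul _).congr_deriv (by field_simp))
    (fun z hz => ((hasDerivAt_logDerivSigma hz).div_const c).congr_deriv (by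
      rw [div_pow (diskModulus z), hr, ← sub_eq_zero]
      field_simp
      linear_combination -8 * (1 - diskModulus z ^ 2) * sigma3 z ^ 8 * hc2))
    (fun z hz => ((hasDerivAt_diskModulus hz).div_const r).congr_deriv (by
      rw [div_pow (diskModulus z), hr, hc]
      field_simp
      linear_combination -2 * sigma3 z ^ 4 * (1 - diskModulus z ^ 2) * hr))
    (by simp [sigma3_zero, hθ]) (by simp [logDerivSigma_zero]) (by simp [diskModulus_zero]) (2 * n)
  refine ⟨k, ?_⟩
  rw [iteratedDeriv_const_mul_field] at hk
  rw [← hc2, ← pow_mul, ← hk, mul_inv_cancel_left₀ hθ]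

/-! ### The arithmetic-geometric mean and Gauss's elliptic integral -/

/-- The complete elliptic integral `∫_ℝ du / √((u² + a²)(u² + b²))`, whose value is `π` divided by
the arithmetic-geometric mean of `a` and `b`. -/
noncomputable def agmIntegral (a b : ℝ) : ℝ :=
  ∫ u : ℝ, (√((u ^ 2 + a ^ 2) * (u ^ 2 + b ^ 2)))⁻¹

theorem agmIntegral_eq_two_mul (a b : ℝ) :
    agmIntegral a b = 2 * ∫ u in Ioi (0 : ℝ), (√((u ^ 2 + a ^ 2) * (u ^ 2 + b ^ 2)))⁻¹ := by
  rw [agmIntegral, ← integral_comp_abs]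
  simp only [sq_abs]

theorem image_sub_div_Ioi {c : ℝ} (hc : 0 < c) :
    (fun t : ℝ => (t - c / t) / 2) '' Ioi 0 = univ := by
  refine eq_univ_of_forall fun u => ?_
  have h1 : |u| < √(u ^ 2 + c) := by
    rw [← Real.sqrt_sq_eq_abs]
    exact Real.sqrt_lt_sqrt (sq_nonneg _) (by linarith)
  have h2 : 0 < u + √(u ^ 2 + c) := by linarith [neg_abs_le u]
  refine ⟨u + √(u ^ 2 + c), h2, ?_⟩
  have h3 : √(u ^ 2 + c) ^ 2 = u ^ 2 + c := Real.sq_sqrt (by positivity)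
  simp only
  field_simp
  linear_combination h3

/-- Gauss's invariance of the elliptic integral under the arithmetic-geometric mean. -/
theorem agmIntegral_agm {a b a' b' : ℝ} (ha : 0 < a) (hb : 0 < b) (ha' : 2 * a' = a + b)
    (hb' : b' ^ 2 = a * b) : agmIntegral a' b' = agmIntegral a b := by
  have hc : 0 < a * b := mul_pos ha hb
  rw [agmIntegral_eq_two_mul a b, agmIntegral, ← setIntegral_univ, ← image_sub_div_Ioi hc,
    integral_image_eq_integral_abs_deriv_smul (f' := fun t => (1 + a * b / t ^ 2) / 2)
      measurableSet_Ioi, ← integral_const_mul]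
  · refine setIntegral_congr_fun measurableSet_Ioi fun t ht => ?_
    have ht : 0 < t := ht
    -- Under u = (t - ab/t)/2 one has u² + a'² = (t² + a²)(t² + b²)/(4t²) and u² + b'² = ((t² +
    -- ab)/(2t))². The Jacobian leaves the factor 2 that comes from folding the line onto t > 0.
    have e : (((t - a * b / t) / 2) ^ 2 + a' ^ 2) * (((t - a * b / t) / 2) ^ 2 + b' ^ 2) =
        ((t ^ 2 + a ^ 2) * (t ^ 2 + b ^ 2)) * ((t ^ 2 + a * b) / (4 * t ^ 2)) ^ 2 := by
      rw [hb', show a' = (a + b) / 2 by linarith]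
      field_simp
      ring
    have h1 : (0 : ℝ) < (1 + a * b / t ^ 2) / 2 := by positivity
    simp only [smul_eq_mul]
    rw [e, Real.sqrt_mul (by positivity), Real.sqrt_sq (by positivity), abs_of_pos h1]
    have h2 : 0 < √((t ^ 2 + a ^ 2) * (t ^ 2 + b ^ 2)) := Real.sqrt_pos.2 (by positivity)
    field_simp
    ring
  · intro t ht
    have ht : t ≠ 0 := ne_of_gt ht
    have h := ((hasDerivAt_id t).sub ((hasDerivAt_const t (a * b)).div (hasDerivAt_id t) ht)).div_const 2
    refine (h.congr_deriv ?_).hasDerivWithinAt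
    simp only [id]
    field_simp
    ring
  · intro s hs t ht hst
    have hs : 0 < s := hs
    have ht : 0 < t := ht
    simp only at hst
    field_simp at hst
    have h : (s - t) * (s * t + a * b) = 0 := by linear_combination hst
    rcases mul_eq_zero.1 h with h | h
    · linarith
    · have := mul_pos hs ht
      linarith

theorem agmIntegral_one_one : agmIntegral 1 1 = Real.pi := by
  rw [agmIntegral, ← integral_univ_inv_one_add_sq]
  congr 1 with u
  rw [Real.sqrt_mul_self (by positivity), one_pow, add_comm]

theorem tendsto_agmIntegral {a b : ℕ → ℝ} (ha : Tendsto a atTop (𝓝 1)) (hb : Tendsto b atTop (𝓝 1)) :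
    Tendsto (fun n => agmIntegral (a n) (b n)) atTop (𝓝 Real.pi) := by
  rw [← agmIntegral_one_one]
  -- The bound holds once both parameters exceed 1/2: then each factor under the root is at least (1
  -- + u²)/4.
  refine tendsto_integral_filter_of_dominated_convergence (fun u => 4 * (1 + u ^ 2)⁻¹)
    (.of_forall fun n => ?_) ?_ (integrable_inv_one_add_sq.const_mul 4) (.of_forall fun u => ?_)
  · exact Measurable.aestronglyMeasurable (by fun_prop)
  · filter_upwards [ha.eventually (lt_mem_nhds (show (1 / 2 : ℝ) < 1 by norm_num)),
      hb.eventually (lt_mem_nhds (show (1 / 2 : ℝ) < 1 by norm_num))] with n h1 h2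
    refine .of_forall fun u => ?_
    rw [Real.norm_of_nonneg (by positivity)]
    have h3 : (1 + u ^ 2) / 4 ≤ u ^ 2 + a n ^ 2 := by nlinarith [sq_nonneg u]
    have h4 : (1 + u ^ 2) / 4 ≤ u ^ 2 + b n ^ 2 := by nlinarith [sq_nonneg u]
    have h5 : (1 + u ^ 2) / 4 ≤ √((u ^ 2 + a n ^ 2) * (u ^ 2 + b n ^ 2)) := by
      refine Real.le_sqrt_of_sq_le ?_
      rw [sq]
      exact mul_le_mul h3 h4 (by positivity) (by positivity)
    calc _ ≤ ((1 + u ^ 2) / 4)⁻¹ := inv_anti₀ (by positivity) h5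
      _ = _ := by rw [inv_div, div_eq_mul_inv]
  · refine Tendsto.inv₀ ?_ ?_
    · exact (Real.continuous_sqrt.tendsto _).comp
        (((ha.pow 2).const_add (u ^ 2)).mul ((hb.pow 2).const_add (u ^ 2)))
    · exact (Real.sqrt_pos.2 (by positivity)).ne'

theorem agmIntegral_mul {c : ℝ} (hc : 0 < c) (a b : ℝ) :
    agmIntegral (c * a) (c * b) = c⁻¹ * agmIntegral a b := by
  have h := Measure.integral_comp_mul_left
    (fun u => (√((u ^ 2 + (c * a) ^ 2) * (u ^ 2 + (c * b) ^ 2)))⁻¹) c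
  rw [abs_of_pos (inv_pos.2 hc), smul_eq_mul] at h
  have h2 : ∀ u : ℝ, (√(((c * u) ^ 2 + (c * a) ^ 2) * ((c * u) ^ 2 + (c * b) ^ 2)))⁻¹ =
      (c ^ 2)⁻¹ * (√((u ^ 2 + a ^ 2) * (u ^ 2 + b ^ 2)))⁻¹ := by
    intro u
    rw [show ((c * u) ^ 2 + (c * a) ^ 2) * ((c * u) ^ 2 + (c * b) ^ 2) =
      (c ^ 2) ^ 2 * ((u ^ 2 + a ^ 2) * (u ^ 2 + b ^ 2)) by ring, Real.sqrt_mul (by positivity),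
      Real.sqrt_sq (by positivity), mul_inv]
  simp only [h2] at h
  rw [integral_const_mul] at h
  change (c ^ 2)⁻¹ * agmIntegral a b = c⁻¹ * agmIntegral (c * a) (c * b) at h
  field_simp at h ⊢
  linear_combination -h

/-! ### The lemniscatic case as a Beta integral -/

theorem image_inv_one_add_sq_sq_Ioi : (fun u : ℝ => ((1 + u ^ 2) ^ 2)⁻¹) '' Ioi 0 = Ioo 0 1 := by
  ext x
  constructor
  · rintro ⟨u, hu, rfl⟩
    have hu : 0 < u := hu
    refine ⟨by positivity, inv_lt_one_of_one_lt₀ ?_⟩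
    nlinarith [pow_pos hu 2]
  · rintro ⟨h0, h1⟩
    have hs : 0 < √x := Real.sqrt_pos.2 h0
    have hs1 : √x < 1 := by
      rw [Real.sqrt_lt' one_pos]; simpa using h1
    have h2 : 0 < (√x)⁻¹ - 1 := by
      have := (one_lt_inv₀ hs).2 hs1
      linarith
    refine ⟨√((√x)⁻¹ - 1), Real.sqrt_pos.2 h2, ?_⟩
    simp only
    rw [Real.sq_sqrt h2.le, add_sub_cancel, inv_pow, inv_inv, Real.sq_sqrt h0.le]

/-- Substitute x = (1 + u²)⁻² in the Beta integral; then 1 - x = u²(u² + 2)/(1 + u²)². -/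
theorem betaIntegral_eq_agmIntegral :
    Complex.betaIntegral (1 / 4) (1 / 2) = ((2 * agmIntegral √2 1 : ℝ) : ℂ) := by
  rw [Complex.betaIntegral, intervalIntegral.integral_of_le zero_le_one, integral_Ioc_eq_integral_Ioo,
    ← image_inv_one_add_sq_sq_Ioi,
    integral_image_eq_integral_abs_deriv_smul (f' := fun u => -(4 * u) / (1 + u ^ 2) ^ 3)
      measurableSet_Ioi, agmIntegral_eq_two_mul, ← integral_const_mul, ← integral_const_mul,
      ← integral_complex_ofReal]
  · refine setIntegral_congr_fun measurableSet_Ioi fun u hu => ?_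
    have hu : 0 < u := hu
    have hw : 0 < 1 + u ^ 2 := by positivity
    have e : (1 : ℝ) - ((1 + u ^ 2) ^ 2)⁻¹ = (u / (1 + u ^ 2)) ^ 2 * (u ^ 2 + 2) := by
      field_simp
      ring
    have h1 : ((((1 + u ^ 2) ^ 2)⁻¹ : ℝ) : ℂ) ^ ((1 / 4 : ℂ) - 1) =
        (((1 + u ^ 2) * √(1 + u ^ 2) : ℝ) : ℂ) := by
      rw [show ((1 / 4 : ℂ) - 1) = ((-(3 / 4) : ℝ) : ℂ) by push_cast; norm_num,
        ← Complex.ofReal_cpow (by positivity)]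
      congr 1
      rw [Real.inv_rpow (by positivity), Real.rpow_neg (by positivity), inv_inv,
        ← Real.rpow_natCast, ← Real.rpow_mul hw.le, Real.sqrt_eq_rpow,
        ← Real.rpow_one_add' hw.le (by norm_num)]
      norm_num
    have h2 : (1 - ((((1 + u ^ 2) ^ 2)⁻¹ : ℝ) : ℂ)) ^ ((1 / 2 : ℂ) - 1) =
        ((u / (1 + u ^ 2) * √(u ^ 2 + 2) : ℝ) : ℂ)⁻¹ := by
      rw [show ((1 / 2 : ℂ) - 1) = ((-(1 / 2) : ℝ) : ℂ) by push_cast; norm_num,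
        ← Complex.ofReal_one, ← Complex.ofReal_sub, e,
        ← Complex.ofReal_cpow (by positivity), ← Complex.ofReal_inv]
      congr 1
      rw [Real.rpow_neg (by positivity), ← Real.sqrt_eq_rpow, Real.sqrt_mul (by positivity),
        Real.sqrt_sq (by positivity)]
    have h3 : |-(4 * u) / (1 + u ^ 2) ^ 3| = 4 * u / (1 + u ^ 2) ^ 3 := by
      rw [neg_div, abs_neg, abs_of_pos (by positivity)]
    rw [h1, h2, h3, ← Complex.ofReal_inv, ← Complex.ofReal_mul, Complex.real_smul,
      ← Complex.ofReal_mul]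
    congr 1
    rw [Real.sq_sqrt (by norm_num), one_pow, Real.sqrt_mul (by positivity), add_comm (u ^ 2) 1]
    have h4 : √(1 + u ^ 2) ^ 2 = 1 + u ^ 2 := Real.sq_sqrt hw.le
    have h5 : 0 < √(1 + u ^ 2) := Real.sqrt_pos.2 hw
    have h6 : 0 < √(u ^ 2 + 2) := Real.sqrt_pos.2 (by positivity)
    field_simp
    linear_combination 4 * h4
  · intro u hu
    have hw : 1 + u ^ 2 ≠ 0 := by positivity
    have h := (((hasDerivAt_pow 2 u).const_add 1).pow 2).inv (pow_ne_zero 2 hw)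
    refine (h.congr_deriv ?_).hasDerivWithinAt
    simp only [Pi.pow_apply]
    field_simp
    norm_num
    ring
  · intro s hs t ht hst
    have hs : 0 < s := hs
    have ht : 0 < t := ht
    simp only [inv_inj] at hst
    have h := (pow_left_inj₀ (by positivity) (by positivity) two_ne_zero).1 hst
    exact (pow_left_inj₀ hs.le ht.le two_ne_zero).1 (add_left_cancel h)

/-- The reflection formula Γ(1/4) Γ(3/4) = π√2 eliminates Γ(3/4) from the Beta value. -/
theorem agmIntegral_sqrt_two_one :
    agmIntegral √2 1 = Real.Gamma (1 / 4) ^ 2 / (2 * √(2 * Real.pi)) := by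
  have h := betaIntegral_eq_agmIntegral
  have hπ := Real.pi_pos
  rw [Complex.betaIntegral_eq_Gamma_mul_div _ _ (by norm_num) (by norm_num)] at h
  have h34 : (1 / 4 : ℂ) + 1 / 2 = ((3 / 4 : ℝ) : ℂ) := by push_cast; norm_num
  rw [h34, show (1 / 4 : ℂ) = ((1 / 4 : ℝ) : ℂ) by push_cast; rfl,
    show (1 / 2 : ℂ) = ((1 / 2 : ℝ) : ℂ) by push_cast; rfl, Complex.Gamma_ofReal,
    Complex.Gamma_ofReal, Complex.Gamma_ofReal, Real.Gamma_one_half_eq] at h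
  norm_cast at h
  have hr := Real.Gamma_mul_Gamma_one_sub (1 / 4)
  rw [show Real.pi * (1 / 4) = Real.pi / 4 by ring, Real.sin_pi_div_four,
    show (1 : ℝ) - 1 / 4 = 3 / 4 by norm_num] at hr
  have h3 : 0 < Real.Gamma (3 / 4) := Real.Gamma_pos_of_pos (by norm_num)
  have h1 : 0 < Real.Gamma (1 / 4) := Real.Gamma_pos_of_pos (by norm_num)
  have hs2 : √2 ^ 2 = 2 := Real.sq_sqrt (by norm_num)
  have hsπ : √Real.pi ^ 2 = Real.pi := Real.sq_sqrt hπ.le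
  have h20 : 0 < √2 := Real.sqrt_pos.2 (by norm_num)
  have hπ0 : 0 < √Real.pi := Real.sqrt_pos.2 hπ
  rw [Real.sqrt_mul (by norm_num)]
  have h3' : Real.Gamma (3 / 4) = Real.pi / (√2 / 2) / Real.Gamma (1 / 4) := by
    rw [← hr]; field_simp
  rw [h3'] at h
  field_simp at h ⊢
  refine mul_left_cancel₀ (mul_pos two_pos hπ).ne' ?_
  linear_combination -(√Real.pi * √2) * h + Real.Gamma (1 / 4) ^ 2 * (√2 ^ 2 * hsπ + Real.pi * hs2)

/-! ### The value of θ₃(1) -/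

/-- The restriction of `nomeTheta` to real nomes. -/
noncomputable def realNomeTheta (q : ℝ) : ℝ := ∑' n : ℤ, q ^ (n.natAbs ^ 2)

theorem ofReal_realNomeTheta (q : ℝ) : (realNomeTheta q : ℂ) = nomeTheta q := by
  rw [realNomeTheta, nomeTheta, Complex.ofReal_tsum]
  push_cast
  rfl

theorem realNomeTheta_pos_of_nonneg {q : ℝ} (h0 : 0 ≤ q) (h1 : q < 1) : 0 < realNomeTheta q :=
  (summable_pow_natAbs_sq h0 h1).tsum_pos (fun _ => by positivity) 0 (by simp)

theorem realNomeTheta_sq_add_sq {q : ℝ} (hq : |q| < 1) :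
    realNomeTheta q ^ 2 + realNomeTheta (-q) ^ 2 = 2 * realNomeTheta (q ^ 2) ^ 2 := by
  have h := nomeTheta_sq_add_sq (q := (q : ℂ)) (by simpa using hq)
  rw [← Complex.ofReal_neg, ← Complex.ofReal_pow] at h
  simp only [← ofReal_realNomeTheta] at h
  exact_mod_cast h

theorem realNomeTheta_mul_neg {q : ℝ} (hq : |q| < 1) :
    realNomeTheta q * realNomeTheta (-q) = realNomeTheta (-q ^ 2) ^ 2 := by
  have h := nomeTheta_mul_nomeTheta_neg (q := (q : ℂ)) (by simpa using hq)
  rw [← Complex.ofReal_pow, ← Complex.ofReal_neg, ← Complex.ofReal_neg] at h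
  simp only [← ofReal_realNomeTheta] at h
  exact_mod_cast h

/-- Its product with the positive value at q is a square, and it is nonzero. -/
theorem realNomeTheta_neg_pos {q : ℝ} (h0 : 0 ≤ q) (h1 : q < 1) : 0 < realNomeTheta (-q) := by
  have hq : |q| < 1 := by rwa [abs_of_nonneg h0]
  have hne : realNomeTheta (-q) ≠ 0 := by
    have h := nomeTheta_neg_ne_zero (q := (q : ℂ)) (by simpa using hq)
    rw [← Complex.ofReal_neg, ← ofReal_realNomeTheta] at h
    exact_mod_cast h
  have h := realNomeTheta_mul_neg hq
  have hpos := realNomeTheta_pos_of_nonneg h0 h1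
  by_contra hneg
  have hneg : realNomeTheta (-q) < 0 := lt_of_le_of_ne (not_lt.1 hneg) hne
  nlinarith [sq_nonneg (realNomeTheta (-q ^ 2)), mul_pos_of_neg_of_neg (neg_neg_of_pos hpos) hneg]

theorem tendsto_realNomeTheta_zero : Tendsto realNomeTheta (𝓝 0) (𝓝 1) := by
  have h : Tendsto (fun q : ℝ => (nomeTheta q).re) (𝓝 0) (𝓝 (nomeTheta (0 : ℝ)).re) := by
    refine (Complex.continuous_re.tendsto _).comp ?_
    have := continuousAt_nomeTheta_zero.tendsto
    rw [← Complex.ofReal_zero] at this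
    exact this.comp (Complex.continuous_ofReal.tendsto 0)
  simpa [← ofReal_realNomeTheta, nomeTheta_zero] using h

/-- The squares of `θ₃` and `θ₄` have arithmetic-geometric mean `1`. -/
theorem agmIntegral_realNomeTheta {q : ℝ} (h0 : 0 ≤ q) (h1 : q < 1) :
    agmIntegral (realNomeTheta q ^ 2) (realNomeTheta (-q) ^ 2) = Real.pi := by
  have hn : ∀ n : ℕ, 0 ≤ q ^ 2 ^ n ∧ q ^ 2 ^ n < 1 := fun n =>
    ⟨by positivity, pow_lt_one₀ h0 h1 (by positivity)⟩
  -- Landen's identities say that doubling the nome is one step of the mean iteration on (θ₃², θ₄²);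
  -- both entries tend to 1.
  have key : ∀ n : ℕ, agmIntegral (realNomeTheta (q ^ 2 ^ n) ^ 2) (realNomeTheta (-q ^ 2 ^ n) ^ 2) =
      agmIntegral (realNomeTheta q ^ 2) (realNomeTheta (-q) ^ 2) := by
    intro n
    induction n with
    | zero => simp
    | succ n ih =>
      obtain ⟨h2, h3⟩ := hn n
      have hq : |q ^ 2 ^ n| < 1 := by rwa [abs_of_nonneg h2]
      rw [← ih, pow_succ 2 n, pow_mul]
      refine agmIntegral_agm (pow_pos (realNomeTheta_pos_of_nonneg h2 h3) 2)
        (pow_pos (realNomeTheta_neg_pos h2 h3) 2) (realNomeTheta_sq_add_sq hq).symm ?_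
      rw [← mul_pow, realNomeTheta_mul_neg hq]
  have hlim : Tendsto (fun n : ℕ => q ^ 2 ^ n) atTop (𝓝 0) :=
    (tendsto_pow_atTop_nhds_zero_of_lt_one h0 h1).comp
      (tendsto_pow_atTop_atTop_of_one_lt one_lt_two)
  have h4 : Tendsto (fun n : ℕ => realNomeTheta (q ^ 2 ^ n) ^ 2) atTop (𝓝 1) := by
    simpa using (tendsto_realNomeTheta_zero.comp hlim).pow 2
  have h5 : Tendsto (fun n : ℕ => realNomeTheta (-q ^ 2 ^ n) ^ 2) atTop (𝓝 1) := by
    have h6 : Tendsto (fun n : ℕ => -q ^ 2 ^ n) atTop (𝓝 0) := by simpa using hlim.neg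
    simpa using (tendsto_realNomeTheta_zero.comp h6).pow 2
  have h7 := tendsto_agmIntegral h4 h5
  simp only [key] at h7
  exact tendsto_nhds_unique tendsto_const_nhds h7

theorem theta3_one_pow_eight :
    (Real.pi : ℂ) ^ 2 * theta3 1 ^ 8 / 8 = (Phi3 : ℂ) := by
  set q : ℝ := Real.exp (-Real.pi) with hq
  have hπ := Real.pi_pos
  have hq0 : 0 ≤ q := (Real.exp_pos _).le
  have hq1 : q < 1 := Real.exp_lt_one_iff.2 (by linarith)
  have hdisk : diskNome 0 = (q : ℂ) := by simp [diskNome, hq]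
  have hθ : theta3 1 = (realNomeTheta q : ℂ) := by
    rw [theta3_eq_nomeTheta, ofReal_realNomeTheta, ← hdisk, diskNome]
    simp
  have ha := realNomeTheta_pos_of_nonneg hq0 hq1
  have hb := realNomeTheta_neg_pos hq0 hq1
  have hm := diskModulus_zero
  rw [diskModulus, hdisk, ← Complex.ofReal_neg, ← ofReal_realNomeTheta, ← ofReal_realNomeTheta] at hm
  norm_cast at hm
  set a := realNomeTheta q with ha_def
  set b := realNomeTheta (-q) with hb_def
  -- The vanishing of m at z = 0 says a⁴ = 2b⁴.
  have hab : (a ^ 2) = b ^ 2 * √2 := by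
    refine (pow_left_inj₀ (by positivity) (by positivity) two_ne_zero).1 ?_
    rw [mul_pow, Real.sq_sqrt (by norm_num)]
    field_simp at hm
    linear_combination hm
  have hI := agmIntegral_realNomeTheta hq0 hq1
  rw [← ha_def, ← hb_def, hab] at hI
  have hI2 := agmIntegral_mul (c := b ^ 2) (by positivity) √2 1
  rw [mul_one, hI, agmIntegral_sqrt_two_one] at hI2
  have hs : √(2 * Real.pi) ^ 2 = 2 * Real.pi := Real.sq_sqrt (by positivity)
  have hs0 : 0 < √(2 * Real.pi) := Real.sqrt_pos.2 (by positivity)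
  have hs2 : √2 ^ 2 = 2 := Real.sq_sqrt (by norm_num)
  have hb2 : b ^ 2 = Real.Gamma (1 / 4) ^ 2 / (2 * √(2 * Real.pi)) / Real.pi := by
    rw [inv_mul_eq_div, eq_div_iff (by positivity)] at hI2
    rw [eq_div_iff hπ.ne', mul_comm, hI2]
  rw [hθ]
  norm_cast
  rw [Phi3, show a ^ 8 = (a ^ 2) ^ 4 by ring, hab, hb2]
  have e1 : √(2 * Real.pi) ^ 4 = 4 * Real.pi ^ 2 := by
    rw [show √(2 * Real.pi) ^ 4 = (√(2 * Real.pi) ^ 2) ^ 2 by ring, hs]; ring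
  have e2 : √2 ^ 4 = 4 := by rw [show √2 ^ 4 = (√2 ^ 2) ^ 2 by ring, hs2]; norm_num
  rw [mul_pow, div_pow, div_pow, mul_pow, e1, e2]
  field_simp
  norm_num

/-! ### The Taylor expansion of σ₃ and its uniqueness -/

theorem iteratedDeriv_sigma3_zero_of_odd {n : ℕ} (hn : Odd n) : iteratedDeriv n sigma3 0 = 0 := by
  have he : (fun z => sigma3 (-z)) =ᶠ[𝓝 0] sigma3 :=
    (eventually_norm_lt_one (by simp)).mono fun w hw => sigma3_neg hw
  have h := he.iteratedDeriv_eq n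
  rw [iteratedDeriv_comp_neg, hn.neg_one_pow, neg_zero, neg_smul, one_smul] at h
  linear_combination -h / 2

theorem isSigmaTaylor_of_iteratedDeriv {a : ℕ → ℂ}
    (ha : ∀ n, iteratedDeriv (2 * n) sigma3 0 = theta3 1 * ((Phi3 : ℂ) ^ n * a n)) :
    IsSigmaTaylor a := by
  intro z hz
  have h := Complex.hasSum_taylorSeries_on_ball differentiableOn_sigma3
    (show z ∈ Metric.ball 0 1 by simpa using hz)
  have hinj : Function.Injective fun n : ℕ => 2 * n := fun a b h => by simpa using h
  rw [← hinj.hasSum_iff] at h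
  · refine h.of_forall_eq fun n => ?_
    simp only [Function.comp_apply, ha, sub_zero, smul_eq_mul]
    ring
  · intro n hn
    have hodd : Odd n := by
      by_contra he
      rw [Nat.not_odd_iff_even] at he
      obtain ⟨k, hk⟩ := he
      exact hn ⟨k, by simp only; omega⟩
    simp [iteratedDeriv_sigma3_zero_of_odd hodd]

theorem eq_zero_of_hasSum_pow_zero {c : ℕ → ℂ}
    (h : ∀ u : ℂ, ‖u‖ < 1 → HasSum (fun n => c n * u ^ n) 0) (n : ℕ) : c n = 0 := by
  have hp : HasFPowerSeriesAt (0 : ℂ → ℂ) (FormalMultilinearSeries.ofScalars ℂ c) 0 := by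
    rw [hasFPowerSeriesAt_iff]
    filter_upwards [eventually_norm_lt_one (q := 0) (by simp)] with u hu
    simpa [FormalMultilinearSeries.coeff_ofScalars, mul_comm] using h u hu
  have h0 : (FormalMultilinearSeries.ofScalars ℂ c).coeff n = 0 := by
    rw [hp.eq_zero]
    rfl
  rwa [FormalMultilinearSeries.coeff_ofScalars] at h0

theorem Omega3_eq : Omega3 = 4 * Phi3 := by
  rw [Omega3, Phi3]
  ring

theorem Phi3_pos : 0 < Phi3 := by
  have := Real.Gamma_pos_of_pos (show (0 : ℝ) < 1 / 4 by norm_num)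
  have := Real.pi_pos
  rw [Phi3]
  positivity

theorem IsSigmaTaylor.unique {a b : ℕ → ℂ} (ha : IsSigmaTaylor a) (hb : IsSigmaTaylor b) (n : ℕ) :
    a n = b n := by
  have hθ : theta3 1 ≠ 0 := theta3_ne_zero (by simp)
  have hΦ : (Phi3 : ℂ) ≠ 0 := by exact_mod_cast Phi3_pos.ne'
  have h := eq_zero_of_hasSum_pow_zero
    (c := fun n => theta3 1 * ((a n - b n) / ((2 * n).factorial : ℂ) * (Phi3 : ℂ) ^ n)) ?_ n
  · have hf : (((2 * n).factorial : ℕ) : ℂ) ≠ 0 := by exact_mod_cast Nat.factorial_ne_zero _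
    simpa [hθ, hΦ, hf, sub_eq_zero] using h
  · intro u hu
    -- Every u in the disk is a square z², so the even series in z becomes a full power series in u.
    obtain ⟨z, rfl⟩ := IsAlgClosed.exists_pow_nat_eq u two_pos
    have hz : ‖z‖ < 1 := by
      rw [norm_pow] at hu
      exact (pow_lt_one_iff_of_nonneg (norm_nonneg z) two_ne_zero).1 hu
    have h := (ha z hz).sub (hb z hz)
    rw [sub_self] at h
    refine h.of_forall_eq fun n => ?_
    rw [← pow_mul]
    ring

/-! ### Transfer to the derivatives of θ₃ at 1 by the Cayley transform -/

/-- The coefficients of `n`-fold differentiation of `(1 + x)^(-1/2) f((1 - x)/(1 + x))`. -/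
noncomputable def cayleyCoeff : ℕ → ℕ → ℂ
  | 0, 0 => 1
  | 0, _ + 1 => 0
  | n + 1, 0 => -(1 / 2 + n) * cayleyCoeff n 0
  | n + 1, j + 1 => -(1 / 2 + n + (j + 1)) * cayleyCoeff n (j + 1) - 2 * cayleyCoeff n j

theorem cayleyCoeff_eq_zero {n j : ℕ} (h : n < j) : cayleyCoeff n j = 0 := by
  induction n generalizing j with
  | zero =>
    obtain ⟨j, rfl⟩ := Nat.exists_eq_succ_of_ne_zero h.ne'
    rw [cayleyCoeff]
  | succ n ih =>
    obtain ⟨j, rfl⟩ := Nat.exists_eq_succ_of_ne_zero (by omega : j ≠ 0)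
    rw [cayleyCoeff, ih (by omega), ih (by omega)]
    ring

/-- The closed form supplies the factorials in `IsThetaTaylor`; it is checked against the recursion,
stated without division and indexed by m = n - j. -/
theorem cayleyCoeff_mul (j m : ℕ) :
    cayleyCoeff (j + m) j * (4 ^ m * (2 * j).factorial * m.factorial) =
      (-1) ^ (j + m) * 2 ^ j * (2 * (j + m)).factorial := by
  obtain ⟨n, hn⟩ : ∃ n, n = j + m := ⟨_, rfl⟩
  have h2 : ∀ k : ℕ, (((2 * (k + 1)).factorial : ℕ) : ℂ) =
      (2 * k + 2) * ((2 * k + 1) * (2 * k).factorial) := by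
    intro k
    rw [show 2 * (k + 1) = 2 * k + 1 + 1 by ring, Nat.factorial_succ, Nat.factorial_succ]
    push_cast
    ring
  induction n generalizing j m with
  | zero =>
    obtain ⟨rfl, rfl⟩ : j = 0 ∧ m = 0 := by omega
    simp [cayleyCoeff]
  | succ n ih =>
    rw [← hn]
    rcases j with _ | j
    · obtain rfl : m = n + 1 := by omega
      have h := ih 0 n (by omega)
      rw [zero_add] at h
      rw [cayleyCoeff, h2, Nat.factorial_succ, pow_succ, pow_succ]
      push_cast
      linear_combination -(4 * (1 / 2 + n) * (n + 1)) * h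
    · have h := ih j m (by omega)
      rw [← show n = j + m by omega] at h
      rcases m with _ | m
      · obtain rfl : j = n := by omega
        rw [cayleyCoeff, cayleyCoeff_eq_zero (Nat.lt_succ_self j), h2, pow_succ]
        linear_combination -2 * (2 * j + 2) * (2 * j + 1) * h
      · have h' := ih (j + 1) m (by omega)
        rw [← show n = j + 1 + m by omega] at h'
        have hn' : (n : ℂ) = j + 1 + m := by exact_mod_cast (show n = j + 1 + m by omega)
        rw [h2 j] at h' ⊢
        rw [cayleyCoeff, h2 n]
        rw [Nat.factorial_succ] at h ⊢
        push_cast at h ⊢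
        simp only [pow_succ] at h h' ⊢
        rw [hn'] at *
        linear_combination -(4 * (1 / 2 + (j + 1 + m) + (j + 1)) * (m + 1)) * h'
          - 2 * (2 * j + 2) * (2 * j + 1) * h

theorem norm_one_sub_div_one_add_lt_one {x : ℂ} (hx : 0 < x.re) : ‖(1 - x) / (1 + x)‖ < 1 := by
  have h : 0 < ‖1 + x‖ := by
    rw [norm_pos_iff]
    intro h
    have := congrArg Complex.re h
    simp at this
    linarith
  rw [norm_div, div_lt_one h]
  refine lt_of_pow_lt_pow_left₀ 2 h.le ?_
  rw [← Complex.normSq_eq_norm_sq, ← Complex.normSq_eq_norm_sq, Complex.normSq_apply,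
    Complex.normSq_apply]
  simp only [Complex.sub_re, Complex.add_re, Complex.one_re, Complex.sub_im, Complex.add_im,
    Complex.one_im]
  nlinarith

theorem isOpen_re_pos : IsOpen {x : ℂ | 0 < x.re} := isOpen_lt continuous_const Complex.continuous_re

/-- With w = (1 - x)/(1 + x) and w' = -2/(1 + x)², differentiating (1 + x)^(-1/2-n-j) f⁽ʲ⁾(w) gives
-(1/2 + n + j) times the term (n+1, j) and -2 times the term (n+1, j+1): the recursion of
`cayleyCoeff`. -/
theorem iteratedDeriv_cayley {f : ℂ → ℂ} (hf : DifferentiableOn ℂ f (Metric.ball 0 1)) (n : ℕ)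
    {x : ℂ} (hx : 0 < x.re) :
    iteratedDeriv n (fun x => (1 + x) ^ (-(1 / 2) : ℂ) * f ((1 - x) / (1 + x))) x =
      ∑ j ∈ Finset.range (n + 1), cayleyCoeff n j *
        ((1 + x) ^ (-(1 / 2) : ℂ) * ((1 + x) ^ (n + j))⁻¹ *
          iteratedDeriv j f ((1 - x) / (1 + x))) := by
  induction n generalizing x with
  | zero => simp [cayleyCoeff]
  | succ n ih =>
    have he : iteratedDeriv n (fun x => (1 + x) ^ (-(1 / 2) : ℂ) * f ((1 - x) / (1 + x))) =ᶠ[𝓝 x]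
        fun x => ∑ j ∈ Finset.range (n + 1), cayleyCoeff n j *
          ((1 + x) ^ (-(1 / 2) : ℂ) * ((1 + x) ^ (n + j))⁻¹ *
            iteratedDeriv j f ((1 - x) / (1 + x))) :=
      eventually_of_mem (isOpen_re_pos.mem_nhds hx) fun y hy => ih hy
    rw [iteratedDeriv_succ, he.deriv_eq]
    have h1 : 1 + x ≠ 0 := by
      intro h
      have := congrArg Complex.re h
      simp at this
      linarith
    have hslit : 1 + x ∈ Complex.slitPlane := Or.inl (by simp; linarith)
    have hz : (1 - x) / (1 + x) ∈ Metric.ball (0 : ℂ) 1 := by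
      simpa only [mem_ball_zero_iff] using norm_one_sub_div_one_add_lt_one hx
    have hid := (hasDerivAt_id x).const_add 1
    have hcay : HasDerivAt (fun x : ℂ => (1 - x) / (1 + x)) (-2 / (1 + x) ^ 2) x := by
      refine (((hasDerivAt_id x).const_sub 1).div hid h1).congr_deriv ?_
      simp only [id]
      ring
    have hder : ∀ j, HasDerivAt (iteratedDeriv j f) (iteratedDeriv (j + 1) f ((1 - x) / (1 + x)))
        ((1 - x) / (1 + x)) := by
      intro j
      rw [iteratedDeriv_succ]
      refine DifferentiableAt.hasDerivAt ?_
      rw [iteratedDeriv_eq_iterate]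
      exact ((hf.analyticAt (Metric.isOpen_ball.mem_nhds hz)).iterated_deriv j).differentiableAt
    set s := (1 + x) ^ (-(1 / 2) : ℂ) with hs
    set F := fun j => s * ((1 + x) ^ (n + 1 + j))⁻¹ * iteratedDeriv j f ((1 - x) / (1 + x)) with hF
    have hterm : ∀ j, HasDerivAt (fun x => cayleyCoeff n j *
        ((1 + x) ^ (-(1 / 2) : ℂ) * ((1 + x) ^ (n + j))⁻¹ *
          iteratedDeriv j f ((1 - x) / (1 + x))))
        (-(1 / 2 + n + j) * cayleyCoeff n j * F j - 2 * cayleyCoeff n j * F (j + 1)) x := by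
      intro j
      have h := (((hid.cpow_const (c := -(1 / 2)) hslit).mul
        ((hid.pow (n + j)).inv (pow_ne_zero _ h1))).mul ((hder j).comp x hcay)).const_mul
        (cayleyCoeff n j)
      refine h.congr_deriv ?_
      have hpow : ((n + j : ℕ) : ℂ) * (1 + x) ^ (n + j - 1) = (n + j) * (1 + x) ^ (n + j) / (1 + x) := by
        rcases Nat.eq_zero_or_pos (n + j) with h0 | h0
        · have : (n : ℂ) + j = 0 := by exact_mod_cast h0
          simp [h0, this]
        · obtain ⟨m, hm⟩ := Nat.exists_eq_succ_of_ne_zero h0.ne'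
          have : (n : ℂ) + j = m + 1 := by exact_mod_cast hm
          rw [this, hm, pow_succ]
          push_cast
          field_simp
      simp only [hF, Function.comp_apply, id, Pi.pow_apply, Complex.cpow_sub _ _ h1,
        Complex.cpow_one, hpow, ← hs, Pi.mul_apply, Pi.inv_apply]
      rw [show n + 1 + (j + 1) = n + j + 2 by ring, show n + 1 + j = n + j + 1 by ring]
      field_simp
      ring
    have hsum := HasDerivAt.fun_sum (u := Finset.range (n + 1)) fun j _ => hterm j
    rw [hsum.deriv, Finset.sum_sub_distrib, Finset.sum_range_succ' _ (n + 1)]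
    -- The sum is extended by a top term, which vanishes because `cayleyCoeff n (n + 1) = 0`, so
    -- that its index can be shifted.
    have h0 := Finset.sum_range_succ (fun j : ℕ => -(1 / 2 + n + j) * cayleyCoeff n j * F j) (n + 1)
    rw [Finset.sum_range_succ', cayleyCoeff_eq_zero (Nat.lt_succ_self n)] at h0
    have h3 : ∑ j ∈ Finset.range (n + 1), cayleyCoeff (n + 1) (j + 1) * F (j + 1) =
        ∑ j ∈ Finset.range (n + 1),
          -(1 / 2 + n + ((j + 1 : ℕ) : ℂ)) * cayleyCoeff n (j + 1) * F (j + 1) -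
        ∑ j ∈ Finset.range (n + 1), 2 * cayleyCoeff n j * F (j + 1) := by
      rw [← Finset.sum_sub_distrib]
      refine Finset.sum_congr rfl fun j _ => ?_
      rw [cayleyCoeff]
      push_cast
      ring
    rw [h3, cayleyCoeff]
    push_cast at h0 ⊢
    linear_combination -h0

/-- The Cayley transform w = (1 - x)/(1 + x) is an involution with (1 + x)(1 + w) = 2. -/
theorem theta3_eq_sigma3 {x : ℂ} (hx : 0 < x.re) :
    theta3 x = 2 ^ (1 / 2 : ℂ) * ((1 + x) ^ (-(1 / 2) : ℂ) * sigma3 ((1 - x) / (1 + x))) := by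
  have h1 : 1 + x ≠ 0 := by
    intro h
    have := congrArg Complex.re h
    simp at this
    linarith
  have hz := one_add_re_pos (norm_one_sub_div_one_add_lt_one hx)
  have e1 : 1 + (1 - x) / (1 + x) = 2 / (1 + x) := by
    field_simp
    ring
  have e2 : (1 - (1 - x) / (1 + x)) / (1 + (1 - x) / (1 + x)) = x := by
    rw [e1]
    field_simp
    ring
  have hx1 : 0 < (1 + x).re := by
    simp
    linarith
  have h2 := Complex.mul_cpow_of_re_pos hx1 hz (-(1 / 2))
  rw [e1, mul_div_cancel₀ _ h1] at h2
  rw [sigma3, e2, e1, ← mul_assoc ((1 + x) ^ _), ← h2, ← mul_assoc, ← Complex.cpow_add _ _ two_ne_zero]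
  simp

theorem iteratedDeriv_theta3_one (n : ℕ) :
    iteratedDeriv n theta3 1 = ∑ j ∈ Finset.range (n + 1),
      cayleyCoeff n j * ((2 ^ (n + j))⁻¹ * iteratedDeriv j sigma3 0) := by
  have he : theta3 =ᶠ[𝓝 1] fun x =>
      2 ^ (1 / 2 : ℂ) * ((1 + x) ^ (-(1 / 2) : ℂ) * sigma3 ((1 - x) / (1 + x))) :=
    eventually_of_mem (isOpen_re_pos.mem_nhds (by simp)) fun x hx => theta3_eq_sigma3 hx
  rw [he.iteratedDeriv_eq n, iteratedDeriv_const_mul_field,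
    iteratedDeriv_cayley differentiableOn_sigma3 n (by simp), Finset.mul_sum]
  refine Finset.sum_congr rfl fun j _ => ?_
  have h : (2 : ℂ) ^ (1 / 2 : ℂ) * 2 ^ (-(1 / 2) : ℂ) = 1 := by
    rw [← Complex.cpow_add _ _ two_ne_zero]
    simp
  rw [one_add_one_eq_two, sub_self, zero_div]
  linear_combination cayleyCoeff n j * ((2 ^ (n + j))⁻¹ * iteratedDeriv j sigma3 0) * h

theorem sum_range_eq_sum_even {g : ℕ → ℂ} (hg : ∀ j, Odd j → g j = 0) (n : ℕ) :
    ∑ j ∈ Finset.range (n + 1), g j = ∑ k ∈ Finset.range (n / 2 + 1), g (2 * k) := by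
  rw [← Finset.sum_image (f := g) (g := fun k => 2 * k) fun a _ b _ h => by simpa using h]
  symm
  refine Finset.sum_subset (fun j hj => ?_) fun j hj hj' => hg j ?_
  · simp only [Finset.mem_image, Finset.mem_range] at hj ⊢
    omega
  · by_contra he
    rw [Nat.not_odd_iff_even] at he
    obtain ⟨k, rfl⟩ := he
    simp only [Finset.mem_image, Finset.mem_range, not_exists, not_and] at hj hj'
    exact hj' k (by omega) (by omega)

theorem isThetaTaylor_of_iteratedDeriv {a : ℕ → ℂ}
    (ha : ∀ n, iteratedDeriv (2 * n) sigma3 0 = theta3 1 * ((Phi3 : ℂ) ^ n * a n)) :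
    IsThetaTaylor a := by
  intro n
  rw [iteratedDeriv_theta3_one, sum_range_eq_sum_even, Finset.mul_sum]
  · refine Finset.sum_congr rfl fun k hk => ?_
    obtain ⟨m, hm⟩ : ∃ m, n = 2 * k + m := ⟨n - 2 * k, by rw [Finset.mem_range] at hk; omega⟩
    have hc := cayleyCoeff_mul (2 * k) m
    rw [ha, Omega3_eq, show n - 2 * k = m by omega]
    subst hm
    have h1 : (((2 * (2 * k)).factorial : ℕ) : ℂ) ≠ 0 := by exact_mod_cast Nat.factorial_ne_zero _
    have h2 : ((m.factorial : ℕ) : ℂ) ≠ 0 := by exact_mod_cast Nat.factorial_ne_zero _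
    rw [← eq_div_iff (by simp [h1, h2])] at hc
    rw [hc, show 4 * k = 2 * (2 * k) by ring]
    push_cast
    have e4 : ∀ i : ℕ, (4 : ℂ) ^ i = 2 ^ i * 2 ^ i := fun i => by rw [← mul_pow]; norm_num
    simp only [mul_pow, e4]
    field_simp
    ring
  · intro j hj
    simp [iteratedDeriv_sigma3_zero_of_odd hj]

theorem IsThetaTaylor.unique {a b : ℕ → ℂ} (ha : IsThetaTaylor a) (hb : IsThetaTaylor b) (n : ℕ) :
    a n = b n := by
  induction n using Nat.strong_induction_on with
  | _ k ih =>
    have hθ : theta3 1 ≠ 0 := theta3_ne_zero (by simp)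
    have hΩ : (Omega3 : ℂ) ≠ 0 := by
      rw [Omega3_eq]
      exact_mod_cast (mul_pos four_pos Phi3_pos).ne'
    -- The system is triangular: the derivative of order 2k involves only a(0), …, a(k), and a(k)
    -- has a nonzero coefficient.
    have h := (ha (2 * k)).symm.trans (hb (2 * k))
    rw [Nat.mul_div_cancel_left k two_pos] at h
    have h1 := mul_left_cancel₀ (mul_ne_zero hθ (by simp)) h
    rw [Finset.sum_range_succ, Finset.sum_range_succ, Finset.sum_congr rfl fun j hj =>
      by rw [ih j (Finset.mem_range.1 hj)]] at h1
    have h2 := mul_right_cancel₀ (pow_ne_zero k hΩ) (add_left_cancel h1)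
    refine mul_left_cancel₀ ?_ h2
    have hf : ∀ i : ℕ, ((i.factorial : ℕ) : ℂ) ≠ 0 := fun i =>
      by exact_mod_cast Nat.factorial_ne_zero i
    exact div_ne_zero (hf _) (mul_ne_zero (mul_ne_zero (pow_ne_zero _ two_ne_zero) (hf _)) (hf _))

theorem theorem2 :
    (∃ d : ℕ → ℤ,
      -- the Taylor expansion of the centered function, with integer `d n`
      IsSigmaTaylor (fun n => (d n : ℂ)) ∧
      -- the expansion determines the numbers `d n`, even among complex sequences
      (∀ a : ℕ → ℂ, IsSigmaTaylor a → ∀ n, a n = (d n : ℂ)) ∧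
      -- they are the numbers which occur in the derivatives of the theta constant at `1`,
      -- and are determined by them as well
      IsThetaTaylor (fun n => (d n : ℂ)) ∧
      (∀ a : ℕ → ℂ, IsThetaTaylor a → ∀ n, a n = (d n : ℂ))) ∧
    -- the centered function is even, equivalently the theta constant is modular
    (∀ z : ℂ, ‖z‖ < 1 → sigma3 (-z) = sigma3 z) ∧
    (∀ x : ℂ, 0 < x.re → theta3 (1 / x) = x ^ (1 / 2 : ℂ) * theta3 x) := by
  refine ⟨?_, fun z hz => sigma3_neg hz, fun x hx => theta3_one_div hx⟩
  have h := exists_int_iteratedDeriv_sigma3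
  simp only [theta3_one_pow_eight] at h
  choose d hd using h
  have hσ := isSigmaTaylor_of_iteratedDeriv (a := fun n => (d n : ℂ)) hd
  have hθ := isThetaTaylor_of_iteratedDeriv (a := fun n => (d n : ℂ)) hd
  exact ⟨d, hσ, fun a ha => ha.unique hσ, hθ, fun a ha => ha.unique hθ⟩
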